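/- **Theorem (The Hagedorn–Hermite correspondence).** Let $d\in\mathbb N$, $\hbar>0$, let $S=\begin{bmatrix}A&B\\ C&D\end{bmatrix}\in\mathsf{Sp}(2d,\mathbb R)$ (that is, $S^TJS=J$ with $J=\begin{bmatrix}0&I_d\\-I_d&0\end{bmatrix}$), put $Q=A+\mathrm iB$, $P=C+\mathrm iD$, and let $z=(q,p)\in\mathbb R^d\times\mathbb R^d$. *Operators.* On the Schwartz space $\mathscr S(\mathbb R^d)$ let $\hat x_jf=x_jf$, $\hat p_jf=-\mathrm i\hbar\,\partial_jf$, $$\hat a_j=\tfrac{1}{\sqrt{2\hbar}}(\hat x_j+\mathrm i\hat p_j),\qquad \hat a_j^*=\tfrac{1}{\sqrt{2\hbar}}(\hat x_j-\mathrm i\hat p_j),$$ $$\mathscr A(S,z)=-\tfrac{\mathrm i}{\sqrt{2\hbar}}\bigl[P^T(\hat x-q)-Q^T(\hat p-p)\bigr],\qquad \mathscr A^*(S,z)=\tfrac{\mathrm i}{\sqrt{2\hbar}}\bigl[P^*(\hat x-q)-Q^*(\hat p-p)\bigr].$$ The Heisenberg–Weyl operator is the unitary operator $(\widehat T_zf)(x)=e^{\frac{\mathrm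 i}{\hbar}p\cdot(x-q/2)}f(x-q)$ on $L^2(\mathbb R^d)$. The metaplectic group $\mathsf{Mp}(2d,\mathbb R)$ is the group of unitary operators on $L^2(\mathbb R^d)$ generated by $\widehat J\psi(x)=(2\pi\hbar\mathrm i)^{-d/2}\int e^{-\frac{\mathrm i}{\hbar}x\cdot y}\psi(y)\,dy$ (extended from $\mathscr S(\mathbb R^d)$), $\widehat V_R\psi(x)=e^{\frac{\mathrm i}{2\hbar}x^TRx}\psi(x)$ for real symmetric $R$, and $\widehat M_L^m\psi(x)=\mathrm i^m\sqrt{|\det L|}\,\psi(Lx)$ for $L\in\mathsf{GL}(d,\mathbb R)$, $m\in\mathbb Z$, $m\pi\equiv\arg\det L \pmod{2\pi}$. The homomorphism $\pi_{\mathsf{Mp}}\colon\mathsf{Mp}(2d,\mathbb R)\to\mathsf{Sp}(2d,\mathbb R)$ is the one that sends these generators to $J$, $\begin{bmatrix}I&0\\R&I\end{bmatrix}$ and $\begin{bmatrix}L^{-1}&0\\0&L^T\end{bmatrix}$; $\widehat S$ is *over* $S$ if $\pi_{\mathsf{Mp}}(\widehat S)=S$. *Functions.* For $n\in\mathbb N_0^d$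 the scaled Hermite function is $\psi_n^\hbar(x)=\hbar^{-d/4}\prod_{j=1}^d\tilde\psi_{n_j}(x_j/\sqrt\hbar)$, where $\tilde\psi_k(t)=\dfrac{H_k(t)}{\sqrt{2^kk!}\,\pi^{1/4}}e^{-t^2/2}$ and $H_0=1$, $H_{k+1}=2tH_k-H_k'$. For a square root $\sigma$ of $\det Q$ (the choice of the branch of $(\det Q)^{1/2}$), the Hagedorn wave packets are $$\varphi_0^\hbar(S,z;x)=\frac{\sigma^{-1}}{(\pi\hbar)^{d/4}}\exp\Bigl\{\tfrac{\mathrm i}{\hbar}\bigl[\tfrac12(x-q)^TPQ^{-1}(x-q)+p\cdot(x-q)\bigr]\Bigr\},$$ $$\varphi_n^\hbar(S,z;\cdot)=\frac{1}{\sqrt{n_1!\cdots n_d!}}\,\mathscr A_1^*(S,z)^{n_1}\cdots\mathscr A_d^*(S,z)^{n_d}\,\varphi_0^\hbar(S,z;\cdot).$$ *Claim.* For every metaplectic operator $\widehat S$ over $S$ there is a square root $\sigma$ of $\det Q$, and conversely for every square root $\sigma$ of $\det Q$ there is a metaplectic operator $\widehat S$ over $S$, such that the single unitary operator $\widehat U=e^{-\frac{\mathrm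 i}{2\hbar}p\cdot q}\,\widehat T_z\,\widehat S$ satisfies $$\varphi_n^\hbar(S,z;\cdot)=\widehat U\,\psi_n^\hbar\qquad\text{for every } n\in\mathbb N_0^d,$$ and the two ladders correspond level by level: for all $n\in\mathbb N_0^d$ and $j\in\{1,\dots,d\}$, $$\psi^\hbar_{n+e_j}=\tfrac{1}{\sqrt{n_j+1}}\hat a_j^*\psi_n^\hbar,\qquad \varphi^\hbar_{n+e_j}=\tfrac{1}{\sqrt{n_j+1}}\mathscr A_j^*(S,z)\varphi_n^\hbar,\qquad \widehat U\,\tfrac{\hat a_j^*}{\sqrt{n_j+1}}\psi_n^\hbar=\tfrac{\mathscr A_j^*(S,z)}{\sqrt{n_j+1}}\varphi_n^\hbar,$$ and, if $n_j\ge1$, $$\psi^\hbar_{n-e_j}=\tfrac{1}{\sqrt{n_j}}\hat a_j\psi_n^\hbar,\qquad \varphi^\hbar_{n-e_j}=\tfrac{1}{\sqrt{n_j}}\mathscr A_j(S,z)\varphi_n^\hbar,\qquad \widehat U\,\tfrac{\hat a_j}{\sqrt{n_j}}\psi_n^\hbar=\tfrac{\mathscr A_j(S,z)}{\sqrt{n_j}}\varphi_n^\hbar.$$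 -/

import Mathlib

open MeasureTheory SchwartzMap Matrix
open scoped ENNReal

noncomputable section

/-- Configuration space `ℝ^d` with its Euclidean structure. -/
abbrev Config (d : ℕ) : Type := EuclideanSpace ℝ (Fin d)

/-- The complex Hilbert space `L²(ℝ^d)`. -/
abbrev L2Space (d : ℕ) : Type := Lp ℂ 2 (volume : Measure (Config d))

section WeightedComposition

variable {d : ℕ} (g : Config d → ℂ) (e : Config d ≃ₜ Config d) (K : ℝ≥0∞)

theorem quasi_of_map_smul (hK0 : K ≠ 0)
    (hmap : K • (volume : Measure (Config d)).map e = volume) :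
    Measure.QuasiMeasurePreserving e (volume : Measure (Config d)) volume := by
  refine ⟨e.continuous.measurable, ?_⟩
  intro s hs
  rw [← hmap] at hs
  simpa [hK0] using hs

theorem quasi_symm_of_map_smul (hmap : K • (volume : Measure (Config d)).map e = volume) :
    Measure.QuasiMeasurePreserving e.symm (volume : Measure (Config d)) volume := by
  refine ⟨e.symm.continuous.measurable, ?_⟩
  refine Measure.AbsolutelyContinuous.mk fun s hs h0 => ?_
  rw [Measure.map_apply e.symm.continuous.measurable hs, ← hmap, Measure.smul_apply,
    Measure.map_apply e.continuous.measurable (e.symm.continuous.measurable hs)]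
  have : e ⁻¹' (e.symm ⁻¹' s) = s := by ext x; simp
  rw [this, h0, smul_zero]

theorem eLpNorm_weighted (hK0 : K ≠ 0) (hK : ∀ x, ‖g x‖ₑ ^ 2 = K)
    (hmap : K • (volume : Measure (Config d)).map e = volume) {f : Config d → ℂ}
    (hf : AEStronglyMeasurable f volume) :
    eLpNorm (fun x => g x * f (e x)) 2 volume = eLpNorm f 2 volume := by
  have hgm : AEMeasurable (fun x => ‖f x‖ₑ ^ 2) (volume : Measure (Config d)) :=
    hf.enorm.pow_const 2
  have hac : (volume : Measure (Config d)).map e ≪ volume :=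
    (quasi_of_map_smul e K hK0 hmap).absolutelyContinuous
  have key : ∫⁻ x, ‖g x * f (e x)‖ₑ ^ 2 = ∫⁻ x, ‖f x‖ₑ ^ 2 := by
    have hKtop : AEMeasurable (fun x => ‖f (e x)‖ₑ ^ 2) (volume : Measure (Config d)) :=
      (hgm.mono_ac hac).comp_measurable e.continuous.measurable
    calc ∫⁻ x, ‖g x * f (e x)‖ₑ ^ 2 = ∫⁻ x, K * ‖f (e x)‖ₑ ^ 2 := by
          refine lintegral_congr fun x => ?_
          rw [enorm_mul, mul_pow, hK]
      _ = K * ∫⁻ x, ‖f (e x)‖ₑ ^ 2 := lintegral_const_mul'' K hKtop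
      _ = K * ∫⁻ x, ‖f x‖ₑ ^ 2 ∂(volume.map e) := by
          rw [lintegral_map' (hgm.mono_ac hac) e.continuous.measurable.aemeasurable]
      _ = ∫⁻ x, ‖f x‖ₑ ^ 2 := by
          conv_rhs => rw [← hmap]
          rw [lintegral_smul_measure, smul_eq_mul]
  rw [eLpNorm_eq_lintegral_rpow_enorm_toReal (by norm_num) (by norm_num),
    eLpNorm_eq_lintegral_rpow_enorm_toReal (by norm_num) (by norm_num)]
  simp only [ENNReal.toReal_ofNat, ENNReal.rpow_ofNat]
  rw [key]

theorem memLp_weighted (hg : Continuous g) (hK0 : K ≠ 0) (hK : ∀ x, ‖g x‖ₑ ^ 2 = K)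
    (hmap : K • (volume : Measure (Config d)).map e = volume) (f : L2Space d) :
    MemLp (fun x => g x * f (e x)) 2 (volume : Measure (Config d)) := by
  refine ⟨hg.aestronglyMeasurable.mul ((Lp.aestronglyMeasurable f).comp_quasiMeasurePreserving
    (quasi_of_map_smul e K hK0 hmap)), ?_⟩
  rw [eLpNorm_weighted g e K hK0 hK hmap (Lp.aestronglyMeasurable f)]
  exact Lp.eLpNorm_lt_top f

/-- The unitary operator `(U f)(x) = g(x) f(e x)` on `L²(ℝ^d)`, where `|g|²` is a constant `K`
that compensates the constant Jacobian of the homeomorphism `e`. -/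
def weightedComp (hg : Continuous g) (hK0 : K ≠ 0) (hK : ∀ x, ‖g x‖ₑ ^ 2 = K)
    (hmap : K • (volume : Measure (Config d)).map e = volume) :
    L2Space d ≃ₗᵢ[ℂ] L2Space d :=
  LinearIsometryEquiv.ofSurjective
    { toFun := fun f => (memLp_weighted g e K hg hK0 hK hmap f).toLp _
      map_add' := by
        intro f h
        rw [← MemLp.toLp_add]
        refine MemLp.toLp_congr _ _ ?_
        filter_upwards [(quasi_of_map_smul e K hK0 hmap).ae (Lp.coeFn_add f h)] with x hx
        simp only [Pi.add_apply] at hx ⊢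
        rw [hx, mul_add]
      map_smul' := by
        intro c f
        rw [RingHom.id_apply, ← MemLp.toLp_const_smul]
        refine MemLp.toLp_congr _ _ ?_
        filter_upwards [(quasi_of_map_smul e K hK0 hmap).ae (Lp.coeFn_smul c f)] with x hx
        simp only [Pi.smul_apply, smul_eq_mul] at hx ⊢
        rw [hx]; ring
      norm_map' := by
        intro f
        change ‖(memLp_weighted g e K hg hK0 hK hmap f).toLp _‖ = ‖f‖
        rw [Lp.norm_toLp, eLpNorm_weighted g e K hK0 hK hmap (Lp.aestronglyMeasurable f),
          Lp.norm_def] }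
    (by
      intro h
      have hg0 : ∀ x, g x ≠ 0 := by
        intro x hx
        apply hK0
        rw [← hK x, hx]; simp
      have hcong : (fun x => g x * (fun y => (g (e.symm y))⁻¹ * h (e.symm y)) (e x)) = h := by
        funext x
        simp [hg0 x]
      have hum : AEStronglyMeasurable (fun y => (g (e.symm y))⁻¹ * h (e.symm y))
          (volume : Measure (Config d)) :=
        ((hg.comp e.symm.continuous).inv₀ (fun y => hg0 _)).aestronglyMeasurable.mul
          ((Lp.aestronglyMeasurable h).comp_quasiMeasurePreserving
            (quasi_symm_of_map_smul e K hmap))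
      have hu : MemLp (fun y => (g (e.symm y))⁻¹ * h (e.symm y)) 2
          (volume : Measure (Config d)) := by
        refine ⟨hum, ?_⟩
        rw [← eLpNorm_weighted g e K hK0 hK hmap hum, hcong]
        exact Lp.eLpNorm_lt_top h
      refine ⟨hu.toLp _, ?_⟩
      apply Lp.ext
      refine (memLp_weighted g e K hg hK0 hK hmap (hu.toLp _)).coeFn_toLp.trans ?_
      filter_upwards [(quasi_of_map_smul e K hK0 hmap).ae hu.coeFn_toLp] with x hx
      rw [hx]
      exact congrFun hcong x)

theorem weightedComp_ae (hg : Continuous g) (hK0 : K ≠ 0) (hK : ∀ x, ‖g x‖ₑ ^ 2 = K)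
    (hmap : K • (volume : Measure (Config d)).map e = volume) (f : L2Space d) :
    weightedComp g e K hg hK0 hK hmap f =ᵐ[volume] fun x => g x * f (e x) :=
  (memLp_weighted g e K hg hK0 hK hmap f).coeFn_toLp

end WeightedComposition

section Operators

variable {d : ℕ}

/-- Multiplication by the scalar phase `e^{iθ}`, as a unitary operator. -/
def phaseOp (θ : ℝ) : L2Space d ≃ₗᵢ[ℂ] L2Space d :=
  weightedComp (fun _ => Complex.exp (Complex.I * θ)) (Homeomorph.refl _) 1 continuous_const
    one_ne_zero (fun _ => by rw [← ofReal_norm]; simp [mul_comm Complex.I, Complex.norm_exp_ofReal_mul_I])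
    (by simp)

/-- The Heisenberg–Weyl operator with parameter `(q, p)`:
`(T f)(x) = exp((i/ħ) p·(x - q/2)) f(x - q)`. -/
def heisenbergWeyl (ħ : ℝ) (q p : Config d) : L2Space d ≃ₗᵢ[ℂ] L2Space d :=
  weightedComp (fun x => Complex.exp (Complex.I * ((ħ⁻¹ * inner ℝ p (x - (2 : ℝ)⁻¹ • q) : ℝ) : ℂ)))
    (Homeomorph.subRight q) 1 (by fun_prop) one_ne_zero
    (fun x => by
      rw [← ofReal_norm, mul_comm Complex.I, Complex.norm_exp_ofReal_mul_I]; simp)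
    (by
      rw [one_smul]
      exact (measurePreserving_sub_right (volume : Measure (Config d)) q).map_eq)

/-- The chirp operator `(V_R f)(x) = exp((i/2ħ) xᵀ R x) f(x)`. -/
def chirpOp (ħ : ℝ) (R : Matrix (Fin d) (Fin d) ℝ) : L2Space d ≃ₗᵢ[ℂ] L2Space d :=
  weightedComp
    (fun x => Complex.exp (Complex.I * (((2 * ħ)⁻¹ * (x.ofLp ⬝ᵥ R *ᵥ x.ofLp) : ℝ) : ℂ)))
    (Homeomorph.refl _) 1
    (by
      refine Complex.continuous_exp.comp (continuous_const.mul (Complex.continuous_ofReal.comp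
        (continuous_const.mul ?_)))
      exact Continuous.dotProduct (by fun_prop) (Continuous.matrix_mulVec continuous_const (by fun_prop)))
    one_ne_zero
    (fun x => by
      rw [← ofReal_norm, mul_comm Complex.I, Complex.norm_exp_ofReal_mul_I]; simp)
    (by simp)

/-- The linear homeomorphism `x ↦ L x` of `ℝ^d`. -/
def linHomeo (L : GL (Fin d) ℝ) : Config d ≃ₜ Config d where
  toFun x := WithLp.toLp 2 ((L : Matrix (Fin d) (Fin d) ℝ) *ᵥ x.ofLp)
  invFun x := WithLp.toLp 2 (((L⁻¹ : GL (Fin d) ℝ) : Matrix (Fin d) (Fin d) ℝ) *ᵥ x.ofLp)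
  left_inv x := by
    simp only [Matrix.mulVec_mulVec, ← Units.val_mul, inv_mul_cancel]; simp
  right_inv x := by
    simp only [Matrix.mulVec_mulVec, ← Units.val_mul, mul_inv_cancel]; simp
  continuous_toFun := (PiLp.continuous_toLp 2 _).comp
    (Continuous.matrix_mulVec continuous_const (PiLp.continuous_ofLp 2 _))
  continuous_invFun := (PiLp.continuous_toLp 2 _).comp
    (Continuous.matrix_mulVec continuous_const (PiLp.continuous_ofLp 2 _))

theorem map_linHomeo (L : GL (Fin d) ℝ) :
    ENNReal.ofReal |(L : Matrix (Fin d) (Fin d) ℝ).det| •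
      (volume : Measure (Config d)).map (linHomeo L) = volume := by
  have hdet : LinearMap.det (Matrix.toEuclideanLin (L : Matrix (Fin d) (Fin d) ℝ)) =
      (L : Matrix (Fin d) (Fin d) ℝ).det := by
    rw [Matrix.toEuclideanLin_eq_toLin_orthonormal, LinearMap.det_toLin]
  have h0 : (L : Matrix (Fin d) (Fin d) ℝ).det ≠ 0 := by
    have := L.isUnit
    rw [Matrix.isUnit_iff_isUnit_det] at this
    exact this.ne_zero
  have h := Measure.map_linearMap_addHaar_eq_smul_addHaar (volume : Measure (Config d))
    (f := Matrix.toEuclideanLin (L : Matrix (Fin d) (Fin d) ℝ)) (by rw [hdet]; exact h0)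
  have hfun : ⇑(linHomeo L) = Matrix.toEuclideanLin (L : Matrix (Fin d) (Fin d) ℝ) := by
    funext x; rfl
  rw [hfun, h, hdet, smul_smul, ← ENNReal.ofReal_mul (abs_nonneg _), ← abs_mul,
    mul_inv_cancel₀ h0]
  simp

/-- The dilation operator `(M_L^m f)(x) = i^m √|det L| f(L x)`. -/
def dilationOp (L : GL (Fin d) ℝ) (m : ℤ) : L2Space d ≃ₗᵢ[ℂ] L2Space d :=
  weightedComp
    (fun _ => Complex.I ^ m * (Real.sqrt |(L : Matrix (Fin d) (Fin d) ℝ).det| : ℂ))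
    (linHomeo L) (ENNReal.ofReal |(L : Matrix (Fin d) (Fin d) ℝ).det|) continuous_const
    (by
      have := L.isUnit
      rw [Matrix.isUnit_iff_isUnit_det] at this
      simpa using this.ne_zero)
    (fun _ => by
      rw [← ofReal_norm, ← ENNReal.ofReal_pow (norm_nonneg _), norm_mul, norm_zpow]
      simp [Real.sq_sqrt])
    (map_linHomeo L)

/-- The homeomorphism `x ↦ x / (2πħ)` of `ℝ^d`. -/
def scaleHomeo {ħ : ℝ} (hħ : 0 < ħ) : Config d ≃ₜ Config d :=
  Homeomorph.smulOfNeZero (2 * Real.pi * ħ)⁻¹ (by positivity)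

/-- The operator `Ĵ = i^{-d/2} F_ħ`, where `F_ħ` is the semiclassical Fourier transform. It is the
unitary extension to `L²(ℝ^d)` of
`(Ĵ f)(x) = (2πħi)^{-d/2} ∫ exp(-(i/ħ) x·y) f(y) dy` on Schwartz functions (see
`fourierOp_schwartz`), obtained from Mathlib's unitary Fourier transform by a dilation. -/
def fourierOp {ħ : ℝ} (hħ : 0 < ħ) : L2Space d ≃ₗᵢ[ℂ] L2Space d :=
  (Lp.fourierTransformₗᵢ (Config d) ℂ).trans <|
    weightedComp (fun _ => ((2 * Real.pi * ħ * Complex.I : ℂ) ^ ((d : ℂ) / 2))⁻¹)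
      (scaleHomeo hħ) (ENNReal.ofReal ((2 * Real.pi * ħ) ^ d)⁻¹) continuous_const
      (by
        have : 0 < ((2 * Real.pi * ħ) ^ d)⁻¹ := by positivity
        simpa using this)
      (fun _ => by
        have h1 : (2 * Real.pi * ħ * Complex.I : ℂ) ≠ 0 := by
          simp [Real.pi_ne_zero, hħ.ne']
        have h2 : (0 : ℝ) < 2 * Real.pi * ħ := by positivity
        have h3 : ‖(2 * Real.pi * ħ * Complex.I : ℂ)‖ = 2 * Real.pi * ħ := by
          simp [abs_of_pos hħ, abs_of_pos Real.pi_pos]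
        rw [← ofReal_norm, ← ENNReal.ofReal_pow (norm_nonneg _), norm_inv,
          Complex.norm_cpow_of_ne_zero h1, h3]
        have him : ((d : ℂ) / 2).im = 0 := by
          have : ((d : ℂ) / 2) = (((d : ℝ) / 2 : ℝ) : ℂ) := by push_cast; rfl
          rw [this, Complex.ofReal_im]
        have hre : ((d : ℂ) / 2).re = (d : ℝ) / 2 := by
          have : ((d : ℂ) / 2) = (((d : ℝ) / 2 : ℝ) : ℂ) := by push_cast; rfl
          rw [this, Complex.ofReal_re]
        rw [him, hre, mul_zero, Real.exp_zero, div_one, inv_pow, ← Real.rpow_natCast,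
          ← Real.rpow_mul h2.le]
        congr 2
        push_cast
        rw [div_mul_cancel₀ _ two_ne_zero, Real.rpow_natCast])
      (by
        have h2 : (0 : ℝ) < 2 * Real.pi * ħ := by positivity
        have h := Measure.map_addHaar_smul (volume : Measure (Config d))
          (r := (2 * Real.pi * ħ)⁻¹) (by positivity)
        have hfun : ⇑(scaleHomeo (d := d) hħ) = fun x => (2 * Real.pi * ħ)⁻¹ • x := by
          funext x; rfl
        rw [hfun]
        change _ • Measure.map ((2 * Real.pi * ħ)⁻¹ • ·) volume = _
        rw [h, smul_smul, ← ENNReal.ofReal_mul (by positivity), finrank_euclideanSpace_fin,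
          inv_pow, inv_inv, abs_of_pos (by positivity), inv_mul_cancel₀ (by positivity)]
        simp)

theorem fourierOp_schwartz {ħ : ℝ} (hħ : 0 < ħ) (f : 𝓢(Config d, ℂ)) :
    fourierOp hħ (f.toLp 2) =ᵐ[volume] fun x =>
      ((2 * Real.pi * ħ * Complex.I : ℂ) ^ ((d : ℂ) / 2))⁻¹ *
        ∫ y : Config d, Complex.exp (-(Complex.I / ħ) * (inner ℝ x y : ℝ)) * f y := by
  have hF : Lp.fourierTransformₗᵢ (Config d) ℂ (f.toLp 2) = (FourierTransform.fourier f).toLp 2 :=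
    SchwartzMap.toLp_fourier_eq f
  have hmap : (volume : Measure (Config d)).map (scaleHomeo hħ) ≪ volume := by
    have h := Measure.map_addHaar_smul (volume : Measure (Config d))
      (r := (2 * Real.pi * ħ)⁻¹) (by positivity)
    change Measure.map ((2 * Real.pi * ħ)⁻¹ • ·) volume ≪ _
    rw [h]
    exact Measure.smul_absolutelyContinuous
  have hq : Measure.QuasiMeasurePreserving (scaleHomeo (d := d) hħ) volume volume :=
    ⟨(scaleHomeo hħ).continuous.measurable, hmap⟩
  simp only [fourierOp, LinearIsometryEquiv.trans_apply]
  rw [hF]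
  refine (weightedComp_ae _ _ _ _ _ _ _ _).trans ?_
  have hae : ∀ᵐ x : Config d, (FourierTransform.fourier f).toLp 2 volume x = FourierTransform.fourier f x :=
    (FourierTransform.fourier f).coeFn_toLp 2 volume
  filter_upwards [hq.ae hae] with x hx
  rw [hx, SchwartzMap.fourier_coe, Real.fourier_eq']
  congr 1
  refine integral_congr_ae (Filter.Eventually.of_forall fun y => ?_)
  simp only [smul_eq_mul]
  congr 2
  have : scaleHomeo hħ x = (2 * Real.pi * ħ)⁻¹ • x := rfl
  rw [this, inner_smul_right, real_inner_comm]
  have hpi : (Real.pi : ℂ) ≠ 0 := by exact_mod_cast Real.pi_ne_zero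
  have hh : (ħ : ℂ) ≠ 0 := by exact_mod_cast hħ.ne'
  push_cast
  field_simp

end Operators

section SchwartzGaussians

variable {d : ℕ}

theorem norm_iteratedFDeriv_cexp_le (n : ℕ) (z : ℂ) :
    ‖iteratedFDeriv ℝ n Complex.exp z‖ ≤ Real.exp z.re := by
  induction n with
  | zero => simp [Complex.norm_exp]
  | succ n ih =>
    have hf : fderiv ℝ Complex.exp = (ContinuousLinearMap.lsmul ℝ ℂ) ∘ Complex.exp := by
      funext w
      have := (Complex.hasDerivAt_exp w).complexToReal_fderiv
      rw [this.fderiv]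
      ext
      simp
    have hc : ContDiff ℝ n Complex.exp := Complex.contDiff_exp
    rw [← norm_iteratedFDeriv_fderiv, hf]
    refine (ContinuousLinearMap.norm_iteratedFDeriv_comp_left _ hc.contDiffAt le_rfl).trans ?_
    calc _ ≤ 1 * Real.exp z.re := by
          gcongr
          exact ContinuousLinearMap.opNorm_lsmul_le
      _ = _ := one_mul _

/-- The exponential of a function of temperate growth whose real part is bounded above by a
negative definite quadratic is a Schwartz function. -/
theorem exists_schwartz_cexp {P : Config d → ℂ} (hP : P.HasTemperateGrowth) {c C : ℝ} (hc : 0 < c)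
    (hre : ∀ x, (P x).re ≤ C - c * ‖x‖ ^ 2) :
    ∃ f : 𝓢(Config d, ℂ), ⇑f = fun x => Complex.exp (P x) := by
  have hsm : ContDiff ℝ (⊤ : ℕ∞) (fun x => Complex.exp (P x)) :=
    (Complex.contDiff_exp).comp hP.1
  refine ⟨⟨fun x => Complex.exp (P x), hsm, ?_⟩, rfl⟩
  intro k n
  obtain ⟨K, D, hD, hb⟩ := hP.norm_iteratedFDeriv_le_uniform n
  -- polynomial times Gaussian is bounded
  obtain ⟨B, hB⟩ : ∃ B, ∀ t : ℝ, 0 ≤ t → (1 + t) ^ (k + K * n) * Real.exp (-c * t ^ 2) ≤ B := by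
    set N := k + K * n
    obtain ⟨B, hB⟩ : ∃ B, ∀ t : ℝ, 0 ≤ t → (1 + t) ^ N * Real.exp (-(1 + t)) ≤ B := by
      refine ⟨N.factorial, fun t ht => ?_⟩
      have h := Real.pow_div_factorial_le_exp (1 + t) (by linarith) N
      rw [Real.exp_neg, ← div_eq_mul_inv, div_le_iff₀ (Real.exp_pos _)]
      rw [div_le_iff₀ (by positivity)] at h
      linarith
    refine ⟨B * Real.exp (1 + 1 / (4 * c)), fun t ht => ?_⟩
    have h1 : Real.exp (-c * t ^ 2) ≤ Real.exp (-(1 + t)) * Real.exp (1 + 1 / (4 * c)) := by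
      rw [← Real.exp_add]
      apply Real.exp_le_exp.mpr
      have h2 : 0 ≤ c * (t - 1 / (2 * c)) ^ 2 := by positivity
      have h3 : c * (t - 1 / (2 * c)) ^ 2 = c * t ^ 2 - t + 1 / (4 * c) := by
        field_simp; ring
      linarith
    calc _ ≤ (1 + t) ^ N * (Real.exp (-(1 + t)) * Real.exp (1 + 1 / (4 * c))) := by gcongr
      _ = (1 + t) ^ N * Real.exp (-(1 + t)) * Real.exp (1 + 1 / (4 * c)) := by ring
      _ ≤ _ := by gcongr; exact hB t ht
  refine ⟨n.factorial * Real.exp C * (1 + D) ^ n * B, fun x => ?_⟩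
  have h1 : ‖iteratedFDeriv ℝ n (fun x => Complex.exp (P x)) x‖ ≤
      n.factorial * Real.exp (P x).re * ((1 + D) * (1 + ‖x‖) ^ K) ^ n := by
    refine norm_iteratedFDeriv_comp_le (N := (⊤ : ℕ∞)) (g := Complex.exp) (f := P)
      (Complex.contDiff_exp) hP.1 (mod_cast le_top) x
      (fun i _ => norm_iteratedFDeriv_cexp_le i (P x)) ?_
    intro i hi hi'
    calc _ ≤ D * (1 + ‖x‖) ^ K := hb i hi' x
      _ ≤ (1 + D) * (1 + ‖x‖) ^ K := by gcongr; simp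
      _ ≤ _ := by
        apply le_self_pow₀ (one_le_mul_of_one_le_of_one_le (by simp [hD]) (by simp [one_le_pow₀]))
        lia
  have h2 : Real.exp (P x).re ≤ Real.exp C * Real.exp (-c * ‖x‖ ^ 2) := by
    rw [← Real.exp_add]
    apply Real.exp_le_exp.mpr
    linarith [hre x]
  have h3 : ‖x‖ ^ k ≤ (1 + ‖x‖) ^ k := by gcongr; simp
  calc ‖x‖ ^ k * ‖iteratedFDeriv ℝ n (fun x => Complex.exp (P x)) x‖
      ≤ (1 + ‖x‖) ^ k * (n.factorial * (Real.exp C * Real.exp (-c * ‖x‖ ^ 2)) *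
          ((1 + D) * (1 + ‖x‖) ^ K) ^ n) := by
        gcongr
        exact h1.trans (by gcongr)
    _ = n.factorial * Real.exp C * (1 + D) ^ n *
          ((1 + ‖x‖) ^ (k + K * n) * Real.exp (-c * ‖x‖ ^ 2)) := by
        rw [mul_pow, ← pow_mul, pow_add]; ring
    _ ≤ _ := by gcongr; exact hB _ (norm_nonneg _)

end SchwartzGaussians

section Symplectic

variable {d : ℕ}

/-- The real symplectic group `Sp(2d, ℝ)`. -/
abbrev Sp (d : ℕ) : Type := Matrix.symplecticGroup (Fin d) ℝ

/-- The matrix `Q = A + iB` of a symplectic matrix `S = [A B; C D]`. -/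
def Qmat (S : Sp d) : Matrix (Fin d) (Fin d) ℂ :=
  S.1.toBlocks₁₁.map Complex.ofReal + Complex.I • S.1.toBlocks₁₂.map Complex.ofReal

/-- The matrix `P = C + iD` of a symplectic matrix `S = [A B; C D]`. -/
def Pmat (S : Sp d) : Matrix (Fin d) (Fin d) ℂ :=
  S.1.toBlocks₂₁.map Complex.ofReal + Complex.I • S.1.toBlocks₂₂.map Complex.ofReal

theorem Qmat_Pmat_relation (S : Sp d) :
    (Qmat S)ᴴ * Pmat S - (Pmat S)ᴴ * Qmat S = (2 * Complex.I) • 1 := by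
  have hS := S.2
  rw [← Matrix.fromBlocks_toBlocks S.1, SymplecticGroup.fromBlocks_mem_iff] at hS
  set A := S.1.toBlocks₁₁
  set B := S.1.toBlocks₁₂
  set C := S.1.toBlocks₂₁
  set D := S.1.toBlocks₂₂
  obtain ⟨e11, e22, e12⟩ := hS
  have e21 : Dᵀ * A - Bᵀ * C = 1 := by
    simpa using congrArg Matrix.transpose e12
  let φ := (Complex.ofRealHom).mapMatrix (m := Fin d)
  have hc : ∀ M : Matrix (Fin d) (Fin d) ℝ, (φ M)ᴴ = φ Mᵀ := by
    intro M; ext i j; simp [φ]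
  have hQ : Qmat S = φ A + Complex.I • φ B := rfl
  have hP : Pmat S = φ C + Complex.I • φ D := rfl
  have f11 := congrArg φ e11
  have f22 := congrArg φ e22
  have f12 := congrArg φ e12
  have f21 := congrArg φ e21
  simp only [map_mul, map_sub, map_one] at f11 f22 f12 f21
  rw [hQ, hP]
  simp only [Matrix.conjTranspose_add, Matrix.conjTranspose_smul, hc, add_mul, mul_add,
    smul_add, smul_mul_assoc, mul_smul_comm, Complex.star_def, Complex.conj_I, neg_mul, neg_smul]
  rw [← f11, ← f22]
  have f12' := congrArg (Complex.I • ·) f12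
  have f21' := congrArg (Complex.I • ·) f21
  simp only [smul_sub] at f12' f21'
  rw [mul_smul, two_smul]
  nth_rw 1 [← f12']
  rw [← f21']
  abel

theorem dotProduct_relation (S : Sp d) (w : Fin d → ℂ) :
    (star (Qmat S *ᵥ w) ⬝ᵥ (Pmat S *ᵥ w)).im = ∑ j, ‖w j‖ ^ 2 := by
  set α := star (Qmat S *ᵥ w) ⬝ᵥ (Pmat S *ᵥ w) with hα
  have h1 : α = star w ⬝ᵥ (((Qmat S)ᴴ * Pmat S) *ᵥ w) := by
    rw [hα, Matrix.star_mulVec, ← Matrix.dotProduct_mulVec, Matrix.mulVec_mulVec]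
  have h2 : star α = star w ⬝ᵥ (((Pmat S)ᴴ * Qmat S) *ᵥ w) := by
    rw [hα, Matrix.star_dotProduct, star_star,
      Matrix.star_mulVec, ← Matrix.dotProduct_mulVec, Matrix.mulVec_mulVec]
  have h3 : α - star α = (2 * Complex.I) * ((∑ j, ‖w j‖ ^ 2 : ℝ) : ℂ) := by
    rw [h2, h1, ← dotProduct_sub, ← Matrix.sub_mulVec, Qmat_Pmat_relation, Matrix.smul_mulVec,
      Matrix.one_mulVec, dotProduct_smul, smul_eq_mul]
    congr 1
    push_cast
    refine Finset.sum_congr rfl fun j _ => ?_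
    simp [Complex.conj_mul']
  have h4 := congrArg Complex.im h3
  simp only [Complex.sub_im, Complex.star_def, Complex.conj_im, Complex.mul_im, Complex.mul_re,
    Complex.ofReal_re, Complex.ofReal_im] at h4
  simp at h4
  linarith

theorem det_Qmat_ne_zero (S : Sp d) : (Qmat S).det ≠ 0 := by
  intro h
  obtain ⟨v, hv, hQ⟩ := Matrix.exists_mulVec_eq_zero_iff.mpr h
  have := dotProduct_relation S v
  rw [hQ, star_zero, zero_dotProduct, Complex.zero_im] at this
  apply hv
  funext j
  have hz := (Finset.sum_eq_zero_iff_of_nonneg (fun i _ => by positivity)).mp this.symm j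
    (Finset.mem_univ j)
  simpa using hz

/-- A real vector, regarded as a complex one. -/
def cvec (x : Config d) : Fin d → ℂ := fun j => (x j : ℂ)

/-- The exponent `(i/ħ) [ ½ (x-q)ᵀ P Q⁻¹ (x-q) + p·(x-q) ]` of a Hagedorn wave packet. -/
def hagedornExponent (ħ : ℝ) (S : Sp d) (q p x : Config d) : ℂ :=
  Complex.I / ħ * (1 / 2 * (cvec (x - q) ⬝ᵥ (Pmat S * (Qmat S)⁻¹) *ᵥ cvec (x - q)) +
    (inner ℝ p (x - q) : ℝ))

theorem hasTemperateGrowth_coord (j : Fin d) :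
    (fun x : Config d => (x j : ℂ)).HasTemperateGrowth :=
  (Complex.ofRealCLM.comp (EuclideanSpace.proj (𝕜 := ℝ) j)).hasTemperateGrowth

theorem hagedornExponent_growth (ħ : ℝ) (S : Sp d) (q p : Config d) :
    (hagedornExponent ħ S q p).HasTemperateGrowth := by
  have hy : ∀ j, (fun x : Config d => cvec (x - q) j).HasTemperateGrowth := by
    intro j
    have h : (fun x : Config d => cvec (x - q) j) =
        (fun x : Config d => (x j : ℂ)) - fun _ => (q j : ℂ) := by
      funext x; simp [cvec]
    rw [h]
    exact (hasTemperateGrowth_coord j).sub (.const _)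
  have hi : (fun x : Config d => ((inner ℝ p (x - q) : ℝ) : ℂ)).HasTemperateGrowth := by
    have h : (fun x : Config d => ((inner ℝ p (x - q) : ℝ) : ℂ)) =
        (Complex.ofReal ∘ fun x => (inner ℝ p x : ℝ)) - fun _ => ((inner ℝ p q : ℝ) : ℂ) := by
      funext x; simp [inner_sub_right]
    rw [h]
    exact (Function.HasTemperateGrowth.comp Function.Complex.hasTemperateGrowth_ofReal
      (Function.hasTemperateGrowth_inner_right p)).sub (.const _)
  have hq : (fun x : Config d =>
      cvec (x - q) ⬝ᵥ (Pmat S * (Qmat S)⁻¹) *ᵥ cvec (x - q)).HasTemperateGrowth := by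
    simp only [dotProduct, Matrix.mulVec]
    refine .sum fun i _ => (hy i).mul (.sum fun j _ => (Function.HasTemperateGrowth.const _).mul (hy j))
  exact (Function.HasTemperateGrowth.const _).mul
    (((Function.HasTemperateGrowth.const _).mul hq).add hi)

theorem sum_norm_mulVec_le (Q : Matrix (Fin d) (Fin d) ℂ) (w : Fin d → ℂ) :
    ∑ i, ‖(Q *ᵥ w) i‖ ^ 2 ≤ (∑ i, ∑ j, ‖Q i j‖ ^ 2) * ∑ j, ‖w j‖ ^ 2 := by
  rw [Finset.sum_mul]
  refine Finset.sum_le_sum fun i _ => ?_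
  have h2 : ‖(Q *ᵥ w) i‖ ≤ ∑ j, ‖Q i j‖ * ‖w j‖ := by
    change ‖∑ j, Q i j * w j‖ ≤ _
    refine (norm_sum_le _ _).trans (le_of_eq ?_)
    exact Finset.sum_congr rfl fun j _ => norm_mul _ _
  calc ‖(Q *ᵥ w) i‖ ^ 2 ≤ (∑ j, ‖Q i j‖ * ‖w j‖) ^ 2 := by gcongr
    _ ≤ _ := Finset.sum_mul_sq_le_sq_mul_sq _ _ _

theorem Qmat_mulVec_inv (S : Sp d) (y : Fin d → ℂ) : Qmat S *ᵥ ((Qmat S)⁻¹ *ᵥ y) = y := by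
  rw [Matrix.mulVec_mulVec, Matrix.mul_nonsing_inv _ (det_Qmat_ne_zero S).isUnit,
    Matrix.one_mulVec]

theorem hagedornExponent_re {ħ : ℝ} (hħ : 0 < ħ) (S : Sp d) (q p x : Config d) :
    (hagedornExponent ħ S q p x).re =
      -(2 * ħ)⁻¹ * ∑ j, ‖((Qmat S)⁻¹ *ᵥ cvec (x - q)) j‖ ^ 2 := by
  have hstar : star (cvec (x - q)) = cvec (x - q) := by
    funext j
    exact Complex.conj_ofReal _
  rw [← dotProduct_relation S, Qmat_mulVec_inv, hstar, Matrix.mulVec_mulVec, hagedornExponent]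
  generalize cvec (x - q) ⬝ᵥ (Pmat S * (Qmat S)⁻¹) *ᵥ cvec (x - q) = β
  have h : Complex.I / (ħ : ℂ) * (1 / 2 * β + ((inner ℝ p (x - q) : ℝ) : ℂ)) =
      Complex.I * ((((2 * ħ)⁻¹ : ℝ) : ℂ) * β + ((ħ⁻¹ * inner ℝ p (x - q) : ℝ) : ℂ)) := by
    push_cast
    have : (ħ : ℂ) ≠ 0 := by exact_mod_cast hħ.ne'
    field_simp
  rw [h, Complex.I_mul_re, Complex.add_im, Complex.im_ofReal_mul, Complex.ofReal_im]
  ring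

theorem hagedornExponent_re_le {ħ : ℝ} (hħ : 0 < ħ) (S : Sp d) (q p : Config d) :
    ∃ c C : ℝ, 0 < c ∧ ∀ x, (hagedornExponent ħ S q p x).re ≤ C - c * ‖x‖ ^ 2 := by
  obtain ⟨M, hMpos, hM⟩ : ∃ M : ℝ, 0 < M ∧ ∀ w : Fin d → ℂ,
      ∑ i, ‖(Qmat S *ᵥ w) i‖ ^ 2 ≤ M * ∑ j, ‖w j‖ ^ 2 := by
    refine ⟨1 + ∑ i, ∑ j, ‖Qmat S i j‖ ^ 2, by positivity, fun w => ?_⟩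
    refine (sum_norm_mulVec_le (Qmat S) w).trans ?_
    gcongr
    linarith
  refine ⟨(4 * ħ * M)⁻¹, (2 * ħ * M)⁻¹ * ‖q‖ ^ 2, by positivity, fun x => ?_⟩
  have hnorm := hM ((Qmat S)⁻¹ *ᵥ cvec (x - q))
  have h1 : ∑ i, ‖cvec (x - q) i‖ ^ 2 = ‖x - q‖ ^ 2 := by
    rw [EuclideanSpace.norm_sq_eq]
    exact Finset.sum_congr rfl fun i _ => by rw [cvec, Complex.norm_real]
  rw [Qmat_mulVec_inv, h1] at hnorm
  rw [hagedornExponent_re hħ]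
  generalize ∑ j, ‖((Qmat S)⁻¹ *ᵥ cvec (x - q)) j‖ ^ 2 = s at hnorm
  have htri : ‖x‖ ^ 2 ≤ 2 * ‖x - q‖ ^ 2 + 2 * ‖q‖ ^ 2 := by
    have h : ‖x‖ ≤ ‖x - q‖ + ‖q‖ := by simpa using norm_add_le (x - q) q
    nlinarith [norm_nonneg x, norm_nonneg (x - q), norm_nonneg q, sq_nonneg (‖x - q‖ - ‖q‖)]
  have e1 : (2 * ħ * M)⁻¹ * ‖q‖ ^ 2 - (4 * ħ * M)⁻¹ * ‖x‖ ^ 2 =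
      (4 * ħ * M)⁻¹ * (2 * ‖q‖ ^ 2 - ‖x‖ ^ 2) := by field_simp; ring
  have e2 : -(2 * ħ)⁻¹ * s = (4 * ħ * M)⁻¹ * (-2 * (M * s)) := by
    field_simp; ring
  rw [e1, e2]
  gcongr
  linarith

end Symplectic

section WavePackets

variable {d : ℕ}

/-- The position operator `x̂_j` on Schwartz functions. -/
def posOp (j : Fin d) : 𝓢(Config d, ℂ) →L[ℂ] 𝓢(Config d, ℂ) :=
  SchwartzMap.smulLeftCLM ℂ (fun x : Config d => (x j : ℂ))

theorem posOp_apply (j : Fin d) (f : 𝓢(Config d, ℂ)) (x : Config d) :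
    posOp j f x = x j * f x := by
  simp [posOp, hasTemperateGrowth_coord j]

/-- The momentum operator `p̂_j = -iħ ∂/∂x_j` on Schwartz functions. -/
def momOp (ħ : ℝ) (j : Fin d) : 𝓢(Config d, ℂ) →L[ℂ] 𝓢(Config d, ℂ) :=
  (-(Complex.I * ħ)) •
    LineDeriv.lineDerivOpCLM ℂ 𝓢(Config d, ℂ) (EuclideanSpace.single j (1 : ℝ))

theorem momOp_apply (ħ : ℝ) (j : Fin d) (f : 𝓢(Config d, ℂ)) (x : Config d) :
    momOp ħ j f x = -(Complex.I * ħ) * lineDeriv ℝ f x (EuclideanSpace.single j 1) := by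
  simp [momOp, SchwartzMap.lineDerivOp_apply]

/-- The lowering operator `â_j = (x̂_j + i p̂_j) / √(2ħ)` of the harmonic oscillator. -/
def hermiteLower (ħ : ℝ) (j : Fin d) : 𝓢(Config d, ℂ) →L[ℂ] 𝓢(Config d, ℂ) :=
  ((Real.sqrt (2 * ħ) : ℂ))⁻¹ • (posOp j + Complex.I • momOp ħ j)

/-- The raising operator `â*_j = (x̂_j - i p̂_j) / √(2ħ)` of the harmonic oscillator. -/
def hermiteRaise (ħ : ℝ) (j : Fin d) : 𝓢(Config d, ℂ) →L[ℂ] 𝓢(Config d, ℂ) :=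
  ((Real.sqrt (2 * ħ) : ℂ))⁻¹ • (posOp j - Complex.I • momOp ħ j)

/-- The Hagedorn lowering operator
`A_j(S,z) = -(i/√(2ħ)) [Pᵀ (x̂ - q) - Qᵀ (p̂ - p)]_j`. -/
def hagedornLower (ħ : ℝ) (S : Sp d) (q p : Config d) (j : Fin d) :
    𝓢(Config d, ℂ) →L[ℂ] 𝓢(Config d, ℂ) :=
  (-(Complex.I / (Real.sqrt (2 * ħ) : ℂ))) •
    ∑ k, ((Pmat S)ᵀ j k • (posOp k - (q k : ℂ) • ContinuousLinearMap.id ℂ _) -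
      (Qmat S)ᵀ j k • (momOp ħ k - (p k : ℂ) • ContinuousLinearMap.id ℂ _))

/-- The Hagedorn raising operator
`A*_j(S,z) = (i/√(2ħ)) [P* (x̂ - q) - Q* (p̂ - p)]_j`. -/
def hagedornRaise (ħ : ℝ) (S : Sp d) (q p : Config d) (j : Fin d) :
    𝓢(Config d, ℂ) →L[ℂ] 𝓢(Config d, ℂ) :=
  (Complex.I / (Real.sqrt (2 * ħ) : ℂ)) •
    ∑ k, ((Pmat S)ᴴ j k • (posOp k - (q k : ℂ) • ContinuousLinearMap.id ℂ _) -
      (Qmat S)ᴴ j k • (momOp ħ k - (p k : ℂ) • ContinuousLinearMap.id ℂ _))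

theorem exists_schwartz_ground {ħ : ℝ} (hħ : 0 < ħ) (S : Sp d) (q p : Config d) (c : ℂ) :
    ∃ f : 𝓢(Config d, ℂ), ⇑f = fun x => c * Complex.exp (hagedornExponent ħ S q p x) := by
  obtain ⟨a, C, ha, h⟩ := hagedornExponent_re_le hħ S q p
  obtain ⟨f, hf⟩ := exists_schwartz_cexp (hagedornExponent_growth ħ S q p) ha h
  exact ⟨c • f, by funext x; simp [hf]⟩

/-- The ground state of the Hagedorn wave packets,
`φ₀(x) = σ⁻¹ (πħ)^{-d/4} exp((i/ħ) [½ (x-q)ᵀ P Q⁻¹ (x-q) + p·(x-q)])`,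
where `σ` is a square root of `det Q`. -/
def hagedornGround {ħ : ℝ} (hħ : 0 < ħ) (S : Sp d) (q p : Config d) (σ : ℂ) :
    𝓢(Config d, ℂ) where
  toFun x := σ⁻¹ * ((Real.pi * ħ) ^ (-(d : ℝ) / 4) : ℝ) * Complex.exp (hagedornExponent ħ S q p x)
  smooth' := by
    obtain ⟨f, hf⟩ := exists_schwartz_ground hħ S q p
      (σ⁻¹ * ((Real.pi * ħ) ^ (-(d : ℝ) / 4) : ℝ))
    rw [← hf]
    exact f.smooth'
  decay' := by
    obtain ⟨f, hf⟩ := exists_schwartz_ground hħ S q p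
      (σ⁻¹ * ((Real.pi * ħ) ^ (-(d : ℝ) / 4) : ℝ))
    rw [← hf]
    exact f.decay'

/-- The Hagedorn wave packets, generated from the ground state by the raising operators:
`φ_n = (n!)^{-1/2} (A*_1)^{n_1} ⋯ (A*_d)^{n_d} φ₀`. -/
def hagedornPacket {ħ : ℝ} (hħ : 0 < ħ) (S : Sp d) (q p : Config d) (σ : ℂ) (n : Fin d → ℕ) :
    𝓢(Config d, ℂ) :=
  ((Real.sqrt (∏ j, ((n j).factorial : ℝ)) : ℝ) : ℂ)⁻¹ •
    (List.ofFn fun j => hagedornRaise ħ S q p j ^ n j).prod (hagedornGround hħ S q p σ)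

/-- The Hermite polynomials `H_0 = 1`, `H_1 = 2X`, `H_2 = 4X² - 2`, … -/
def hermitePoly : ℕ → Polynomial ℝ
  | 0 => 1
  | n + 1 => 2 * Polynomial.X * hermitePoly n - Polynomial.derivative (hermitePoly n)

/-- The one-dimensional Hermite functions
`H_n(t) / (√(2ⁿ n!) π^{1/4}) exp(-t²/2)`. -/
def hermiteFun1 (n : ℕ) (t : ℝ) : ℝ :=
  (hermitePoly n).eval t / (Real.sqrt (2 ^ n * n.factorial) * Real.pi ^ (1 / 4 : ℝ)) *
    Real.exp (-t ^ 2 / 2)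

theorem exists_schwartz_hermite {ħ : ℝ} (hħ : 0 < ħ) (n : Fin d → ℕ) :
    ∃ f : 𝓢(Config d, ℂ), ⇑f = fun x : Config d =>
      ((ħ ^ (-(d : ℝ) / 4) * ∏ j, hermiteFun1 (n j) (x j / Real.sqrt ħ) : ℝ) : ℂ) := by
  have hg : (fun x : Config d => (((-(2 * ħ)⁻¹) * ‖x‖ ^ 2 : ℝ) : ℂ)).HasTemperateGrowth :=
    Function.HasTemperateGrowth.comp Function.Complex.hasTemperateGrowth_ofReal
      ((Function.HasTemperateGrowth.const _).mul (Function.hasTemperateGrowth_norm_sq _))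
  obtain ⟨f, hf⟩ := exists_schwartz_cexp (c := (2 * ħ)⁻¹) (C := 0) hg (by positivity)
    (fun x => by rw [Complex.ofReal_re]; linarith)
  have hpoly : ∀ (p : Polynomial ℝ) (j : Fin d),
      (fun x : Config d => ((p.eval (x j / Real.sqrt ħ) : ℝ) : ℂ)).HasTemperateGrowth := by
    intro p j
    induction p using Polynomial.induction_on' with
    | add a b ha hb =>
      simp only [Polynomial.eval_add, Complex.ofReal_add]
      exact ha.add hb
    | monomial m a =>
      simp only [Polynomial.eval_monomial, div_eq_mul_inv, Complex.ofReal_mul, Complex.ofReal_pow]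
      exact (Function.HasTemperateGrowth.const _).mul
        (((hasTemperateGrowth_coord j).mul (.const _)).pow m)
  have hprod : ∀ s : Finset (Fin d), (fun x : Config d =>
      ∏ j ∈ s, (((hermitePoly (n j)).eval (x j / Real.sqrt ħ) : ℝ) : ℂ)).HasTemperateGrowth := by
    intro s
    classical
    induction s using Finset.induction_on with
    | empty => simp
    | insert a s has ih =>
      simp only [Finset.prod_insert has]
      exact (hpoly _ a).mul ih
  refine ⟨((ħ ^ (-(d : ℝ) / 4) * (∏ j, (Real.sqrt (2 ^ n j * (n j).factorial) *
    Real.pi ^ (1 / 4 : ℝ))⁻¹) : ℝ) : ℂ) • SchwartzMap.smulLeftCLM ℂ (fun x : Config d =>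
      ∏ j, (((hermitePoly (n j)).eval (x j / Real.sqrt ħ) : ℝ) : ℂ)) f, ?_⟩
  funext x
  have hexp : Real.exp (-(2 * ħ)⁻¹ * ‖x‖ ^ 2) =
      ∏ j, Real.exp (-(x j / Real.sqrt ħ) ^ 2 / 2) := by
    rw [← Real.exp_sum, EuclideanSpace.norm_sq_eq, Finset.mul_sum]
    congr 1
    refine Finset.sum_congr rfl fun j _ => ?_
    rw [div_pow, Real.sq_sqrt hħ.le, Real.norm_eq_abs, sq_abs]
    field_simp
  rw [_root_.smul_apply, SchwartzMap.smulLeftCLM_apply_apply (hprod _), hf]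
  simp only [smul_eq_mul]
  rw [← Complex.ofReal_exp, hexp, ← Complex.ofReal_prod, ← Complex.ofReal_mul,
    ← Complex.ofReal_mul]
  congr 1
  simp only [hermiteFun1, div_eq_mul_inv, Finset.prod_mul_distrib]
  ring

/-- The semiclassically scaled Hermite functions
`ψ_n(x) = ħ^{-d/4} ∏_j ψ̃_{n_j}(x_j / √ħ)`. -/
def hermiteFunction {ħ : ℝ} (hħ : 0 < ħ) (n : Fin d → ℕ) : 𝓢(Config d, ℂ) where
  toFun x := ((ħ ^ (-(d : ℝ) / 4) * ∏ j, hermiteFun1 (n j) (x j / Real.sqrt ħ) : ℝ) : ℂ)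
  smooth' := by
    obtain ⟨f, hf⟩ := exists_schwartz_hermite hħ n
    rw [← hf]
    exact f.smooth'
  decay' := by
    obtain ⟨f, hf⟩ := exists_schwartz_hermite hħ n
    rw [← hf]
    exact f.decay'

end WavePackets

section Metaplectic

variable {d : ℕ}

/-- The symplectic matrix `J = [0 I; -I 0]`. -/
def spJ : Sp d :=
  ⟨Matrix.fromBlocks 0 1 (-1) 0, by rw [SymplecticGroup.fromBlocks_mem_iff]; simp⟩

/-- The symplectic matrix `V_R = [I 0; R I]`, for `R` symmetric. -/
def spV (R : Matrix (Fin d) (Fin d) ℝ) (hR : R.IsSymm) : Sp d :=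
  ⟨Matrix.fromBlocks 1 0 R 1, by rw [SymplecticGroup.fromBlocks_mem_iff]; simp [hR.eq]⟩

/-- The symplectic matrix `M_L = [L⁻¹ 0; 0 Lᵀ]`. -/
def spM (L : GL (Fin d) ℝ) : Sp d :=
  ⟨Matrix.fromBlocks ((L⁻¹ : GL (Fin d) ℝ) : Matrix (Fin d) (Fin d) ℝ) 0 0
      (L : Matrix (Fin d) (Fin d) ℝ)ᵀ, by
    rw [SymplecticGroup.fromBlocks_mem_iff]
    refine ⟨by simp, by simp, ?_⟩
    rw [← Matrix.transpose_mul, ← Units.val_mul, mul_inv_cancel]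
    simp⟩

/-- The graph of the covering homomorphism `π : Mp(2d, ℝ) → Sp(2d, ℝ)`, as a subgroup of
`U(L²(ℝ^d)) × Sp(2d, ℝ)`: the metaplectic group is generated by the operators `Ĵ`, `V̂_R` (with `R`
symmetric) and `M̂_L^m` (with `L` invertible and `mπ ≡ arg (det L)` modulo `2π`, that is, `(-1)^m`
is the sign of `det L`), and `π` is the homomorphism that maps them to `J`, `V_R` and `M_L`. -/
def metaplecticGraph {ħ : ℝ} (hħ : 0 < ħ) : Subgroup ((L2Space d ≃ₗᵢ[ℂ] L2Space d) × Sp d) :=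
  Subgroup.closure
    ({(fourierOp hħ, spJ)} ∪
      {x | ∃ (R : Matrix (Fin d) (Fin d) ℝ) (hR : R.IsSymm), x = (chirpOp ħ R, spV R hR)} ∪
      {x | ∃ (L : GL (Fin d) ℝ) (m : ℤ),
        0 < (-1 : ℝ) ^ m * (L : Matrix (Fin d) (Fin d) ℝ).det ∧ x = (dilationOp L m, spM L)})

/-- `T` is a metaplectic operator over the symplectic matrix `S`, that is, `T ∈ Mp(2d, ℝ)` and
`π T = S`. -/
def IsMetaplecticOver {ħ : ℝ} (hħ : 0 < ħ) (T : L2Space d ≃ₗᵢ[ℂ] L2Space d) (S : Sp d) : Prop :=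
  (T, S) ∈ metaplecticGraph hħ

/-- The unitary operator `e^{-(i/2ħ) p·q} T_z Ŝ`, with `z = (q, p)`. -/
def correspondenceOp (ħ : ℝ) (q p : Config d) (T : L2Space d ≃ₗᵢ[ℂ] L2Space d) :
    L2Space d ≃ₗᵢ[ℂ] L2Space d :=
  phaseOp (-(inner ℝ p q) / (2 * ħ)) * heisenbergWeyl ħ q p * T

/-- The correspondence of the ladders `ψ_n` (with operators `â_j`, `â*_j`) and `φ_n` (with operators
`A_j`, `A*_j`) under a unitary operator `U`: it maps `ψ_n` to `φ_n` for every `n`, and for each `j`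
it intertwines the lowering steps `n → n - e_j` (for `n_j ≥ 1`) and the raising steps
`n → n + e_j` of the two ladders; all arrows of the two square diagrams are listed. -/
structure LadderCorrespondence (U : L2Space d ≃ₗᵢ[ℂ] L2Space d)
    (ψ φ : (Fin d → ℕ) → 𝓢(Config d, ℂ))
    (a a' A A' : Fin d → 𝓢(Config d, ℂ) →L[ℂ] 𝓢(Config d, ℂ)) : Prop where
  map_eq : ∀ n, (φ n).toLp 2 = U ((ψ n).toLp 2)
  lower_left : ∀ n j, 1 ≤ n j → ψ (n - Pi.single j 1) = ((Real.sqrt (n j) : ℝ) : ℂ)⁻¹ • a j (ψ n)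
  lower_right : ∀ n j, 1 ≤ n j → φ (n - Pi.single j 1) = ((Real.sqrt (n j) : ℝ) : ℂ)⁻¹ • A j (φ n)
  lower_comm : ∀ n j, 1 ≤ n j →
    U ((((Real.sqrt (n j) : ℝ) : ℂ)⁻¹ • a j (ψ n)).toLp 2) =
      (((Real.sqrt (n j) : ℝ) : ℂ)⁻¹ • A j (φ n)).toLp 2
  raise_left : ∀ n j,
    ψ (n + Pi.single j 1) = ((Real.sqrt (n j + 1) : ℝ) : ℂ)⁻¹ • a' j (ψ n)
  raise_right : ∀ n j,
    φ (n + Pi.single j 1) = ((Real.sqrt (n j + 1) : ℝ) : ℂ)⁻¹ • A' j (φ n)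
  raise_comm : ∀ n j,
    U ((((Real.sqrt (n j + 1) : ℝ) : ℂ)⁻¹ • a' j (ψ n)).toLp 2) =
      (((Real.sqrt (n j + 1) : ℝ) : ℂ)⁻¹ • A' j (φ n)).toLp 2

end Metaplectic

end

/-! Two facts carry the theorem: symplectic covariance of the operators, and transport of the ground
state up to the sign of a square root.

Covariance: conjugation by a metaplectic operator over `S` sends `v·x̂ - u·p̂` to the operator
attached to `S(u, v)`, and the phase-corrected Heisenberg–Weyl operator replaces `x̂, p̂` by `x̂ -
q, p̂ - p`. The oscillator operators `â_j`, `â*_j` belong to the vectors `(e_j, ie_j)` and `(e_j,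
-ie_j)`. `S` maps these to the `j`-th columns of `(Q, P)` and of its conjugate, which are the
coefficients of `A_j` and `A*_j`. So the unitary `U` intertwines the two sets of ladder operators on
Schwartz functions (`IsMetaplecticOver.isCovariant`, `IsCovariant.correspondenceOp_phaseSpaceOp`).

Ground state: metaplectic operators permute the centred Gaussians with parameter `PQ⁻¹` and
amplitude `(det Q)^{-1/2}`, by left multiplication on the symplectic label and up to the sign of the
root (`IsMetaplecticOver.transformsGaussians`). The function `ψ₀` is the Gaussian labelled by the
identity.

Both properties are stable under products and inverses, so they need checking only on the three
kinds of generators. Since membership over `S` is membership in a subgroup of pairs, no relation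
among generators is needed. Raising `ψ₀` and `φ₀` gives `Uψ_n = φ_n`. The ladder relations are
computed for Hermite functions only and carried to the wave packets by `U`.

For the converse, the generators reach every `S` (`exists_isMetaplecticOver`), and `-1` lies over
the identity, which realises the other square root. -/

noncomputable section

/-! ### Generation of the symplectic group and existence of metaplectic lifts -/

section SymplecticGeneration

variable {d : ℕ}

theorem toBlocks_relations (S : Sp d) :
    (S.1.toBlocks₁₁)ᵀ * S.1.toBlocks₂₁ = (S.1.toBlocks₂₁)ᵀ * S.1.toBlocks₁₁ ∧
      (S.1.toBlocks₁₂)ᵀ * S.1.toBlocks₂₂ = (S.1.toBlocks₂₂)ᵀ * S.1.toBlocks₁₂ ∧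
      (S.1.toBlocks₁₁)ᵀ * S.1.toBlocks₂₂ - (S.1.toBlocks₂₁)ᵀ * S.1.toBlocks₁₂ = 1 := by
  have hS := S.2
  rwa [← Matrix.fromBlocks_toBlocks S.1, SymplecticGroup.fromBlocks_mem_iff] at hS

/-- Some real combination `A + tB` of the upper blocks of a symplectic matrix is invertible. -/
theorem exists_det_add_smul_ne_zero (S : Sp d) :
    ∃ t : ℝ, (S.1.toBlocks₁₁ + t • S.1.toBlocks₁₂).det ≠ 0 := by
  set A := S.1.toBlocks₁₁
  set B := S.1.toBlocks₁₂
  -- The determinant of `A + XB` is a nonzero polynomial because its value at `X = i` is `det Q ≠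
  -- 0`. A nonzero real polynomial has a real non-root.
  let N : Matrix (Fin d) (Fin d) (Polynomial ℝ) :=
    A.map (Polynomial.C : ℝ → Polynomial ℝ) +
      (Polynomial.X : Polynomial ℝ) • B.map (Polynomial.C : ℝ → Polynomial ℝ)
  have hN : N.det ≠ 0 := by
    intro h
    apply det_Qmat_ne_zero S
    have h2 : Polynomial.eval₂RingHom Complex.ofRealHom Complex.I N.det = (Qmat S).det := by
      rw [RingHom.map_det]
      congr 1
      ext i j
      simp [N, Qmat, A, B]
      ring
    rw [← h2, h, map_zero]
  obtain ⟨t, ht⟩ := Polynomial.exists_eval_ne_zero_of_natDegree_lt_card N.det hN (by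
    rw [Cardinal.mk_real]; exact (Cardinal.natCast_lt_aleph0).trans_le Cardinal.aleph0_le_continuum)
  refine ⟨t, fun h => ht ?_⟩
  have h2 : (Polynomial.evalRingHom t) N.det = (A + t • B).det := by
    rw [RingHom.map_det]
    congr 1
    ext i j
    simp [N, A, B]
    ring
  rw [← h, ← h2]
  rfl

theorem spM_one : spM (1 : GL (Fin d) ℝ) = 1 := by
  apply Subtype.ext
  simp [spM]

/-- A free symplectic matrix, i.e. one with invertible upper right block, factors into the
standard generators. -/
theorem eq_mul_of_isUnit_toBlocks₁₂ (S : Sp d) (L : GL (Fin d) ℝ)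
    (hL : ((L⁻¹ : GL (Fin d) ℝ) : Matrix (Fin d) (Fin d) ℝ) = S.1.toBlocks₁₂) :
    ∃ (R₁ R₂ : Matrix (Fin d) (Fin d) ℝ) (h₁ : R₁.IsSymm) (h₂ : R₂.IsSymm),
      S = spV R₁ h₁ * spM L * spJ * spV R₂ h₂ := by
  obtain ⟨e11, e22, e12⟩ := toBlocks_relations S
  set A := S.1.toBlocks₁₁ with hA
  set C := S.1.toBlocks₂₁ with hC
  set D := S.1.toBlocks₂₂ with hD
  set B := S.1.toBlocks₁₂ with hB
  set G := (L : Matrix (Fin d) (Fin d) ℝ) with hG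
  have hGB : G * B = 1 := by rw [← hL, hG, ← Units.val_mul, mul_inv_cancel]; rfl
  have hBG : B * G = 1 := by rw [← hL, hG, ← Units.val_mul, inv_mul_cancel]; rfl
  have hBG' : Bᵀ * Gᵀ = 1 := by rw [← transpose_mul, hGB, transpose_one]
  have hGB' : Gᵀ * Bᵀ = 1 := by rw [← transpose_mul, hBG, transpose_one]
  have e21 : Dᵀ * A - Bᵀ * C = 1 := by
    simpa using congrArg Matrix.transpose e12
  have key : D * G = Gᵀ * Dᵀ := by
    calc D * G = Gᵀ * Bᵀ * D * G := by rw [hGB', one_mul]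
      _ = Gᵀ * (Bᵀ * D) * G := by simp only [mul_assoc]
      _ = Gᵀ * Dᵀ := by rw [e22, mul_assoc, mul_assoc, hBG, mul_one]
  have hCe : C = D * G * A - Gᵀ := by
    calc C = Gᵀ * (Bᵀ * C) := by rw [← mul_assoc, hGB', one_mul]
      _ = Gᵀ * (Dᵀ * A - 1) := by rw [← e21]; congr 1; abel
      _ = _ := by rw [mul_sub, mul_one, ← mul_assoc, ← key]
  have h₁ : (D * G).IsSymm := by rw [IsSymm, transpose_mul, key]
  have h₂ : (G * A).IsSymm := by
    -- A relation between rows rather than columns: it comes from the transpose of `S`, which is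
    -- again symplectic.
    have hAB : A * Bᵀ = B * Aᵀ := by
      have hT := SymplecticGroup.transpose_mem S.2
      rw [← Matrix.fromBlocks_toBlocks S.1, fromBlocks_transpose,
        SymplecticGroup.fromBlocks_mem_iff] at hT
      simpa using hT.1
    rw [IsSymm, transpose_mul]
    calc Aᵀ * Gᵀ = G * (B * Aᵀ) * Gᵀ := by rw [← mul_assoc, hGB, one_mul]
      _ = G * A := by rw [← hAB, mul_assoc, mul_assoc, hBG', mul_one]
  -- The four factors multiply to upper left block `B * R₂` and lower right block `R₁ * B`, which
  -- forces `R₂ = B⁻¹A` and `R₁ = DB⁻¹`, with `G = B⁻¹`. The lower left block then agrees by `hCe`.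
  refine ⟨D * G, G * A, h₁, h₂, Subtype.ext ?_⟩
  change S.1 = fromBlocks 1 0 (D * G) 1 * fromBlocks ((L⁻¹ : GL (Fin d) ℝ) : Matrix _ _ ℝ) 0 0
      (L : Matrix (Fin d) (Fin d) ℝ)ᵀ * fromBlocks 0 1 (-1) 0 * fromBlocks 1 0 (G * A) 1
  rw [hL, ← hG]
  simp only [fromBlocks_multiply]
  conv_lhs => rw [← Matrix.fromBlocks_toBlocks S.1, ← hA, ← hB, ← hC, ← hD, hCe]
  congr 1
  · simp [← mul_assoc, hBG]
  · simp
  · simp only [mul_zero, mul_one, one_mul, add_zero, zero_add, mul_neg]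
    rw [mul_assoc D G B, hGB, mul_one, sub_eq_add_neg, mul_assoc, add_comm]
  · simp [mul_assoc, hGB]

/-- Surjectivity of the covering. Free matrices are products of generators. Right multiplication by
`V_{tI} J` turns the upper right block of `S` into `A + tB`, so a suitable `t` makes the product
free, and the extra factors are then divided out. -/
theorem exists_isMetaplecticOver {ħ : ℝ} (hħ : 0 < ħ) (S : Sp d) :
    ∃ T, IsMetaplecticOver hħ T S := by
  have hJ : IsMetaplecticOver (d := d) hħ (fourierOp hħ) spJ :=
    Subgroup.subset_closure (Or.inl (Or.inl rfl))
  have hV : ∀ (R : Matrix (Fin d) (Fin d) ℝ) (hR : R.IsSymm),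
      IsMetaplecticOver hħ (chirpOp ħ R) (spV R hR) := fun R hR =>
    Subgroup.subset_closure (Or.inl (Or.inr ⟨R, hR, rfl⟩))
  have hM : ∀ L : GL (Fin d) ℝ, ∃ m : ℤ, IsMetaplecticOver hħ (dilationOp L m) (spM L) := by
    intro L
    have hdet : (L : Matrix (Fin d) (Fin d) ℝ).det ≠ 0 :=
      ((Matrix.isUnit_iff_isUnit_det _).mp L.isUnit).ne_zero
    rcases hdet.lt_or_gt with h | h
    · exact ⟨1, Subgroup.subset_closure (Or.inr ⟨L, 1, by simpa using h, rfl⟩)⟩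
    · exact ⟨0, Subgroup.subset_closure (Or.inr ⟨L, 0, by simpa using h, rfl⟩)⟩
  have hfree : ∀ S' : Sp d, S'.1.toBlocks₁₂.det ≠ 0 → ∃ T, IsMetaplecticOver hħ T S' := by
    intro S' hS'
    let B : GL (Fin d) ℝ := Matrix.GeneralLinearGroup.mkOfDetNeZero _ hS'
    obtain ⟨R₁, R₂, h₁, h₂, h⟩ := eq_mul_of_isUnit_toBlocks₁₂ S' B⁻¹ (by rw [inv_inv]; rfl)
    obtain ⟨m, hm⟩ := hM B⁻¹
    rw [h]
    exact ⟨_, mul_mem (mul_mem (mul_mem (hV R₁ h₁) hm) hJ) (hV R₂ h₂)⟩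
  obtain ⟨t, ht⟩ := exists_det_add_smul_ne_zero S
  have hR : (t • (1 : Matrix (Fin d) (Fin d) ℝ)).IsSymm := by simp [IsSymm]
  obtain ⟨T, hT⟩ := hfree (S * spV _ hR * spJ) (by
    have : (S * spV _ hR * spJ).1.toBlocks₁₂ = S.1.toBlocks₁₁ + t • S.1.toBlocks₁₂ := by
      change (S.1 * fromBlocks 1 0 (t • (1 : Matrix (Fin d) (Fin d) ℝ)) 1 *
        fromBlocks 0 1 (-1) 0).toBlocks₁₂ = _
      conv_lhs => rw [← Matrix.fromBlocks_toBlocks S.1]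
      simp [fromBlocks_multiply]
    rwa [this])
  have h := mul_mem (mul_mem hT (inv_mem hJ)) (inv_mem (hV _ hR))
  refine ⟨T * (fourierOp hħ)⁻¹ * (chirpOp ħ (t • 1))⁻¹, ?_⟩
  unfold IsMetaplecticOver
  convert h using 1
  ext1
  · rfl
  · simp

/-- Only the parity of `m` is prescribed, so `L = 1` admits `m = 2`, with scalar factor `i² = -1`.
This is the second lift of the identity. -/
theorem isMetaplecticOver_neg_one {ħ : ℝ} (hħ : 0 < ħ) :
    IsMetaplecticOver (d := d) hħ (dilationOp 1 2) 1 :=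
  Subgroup.subset_closure (Or.inr ⟨1, 2, by simp, by rw [spM_one]⟩)

theorem dilationOp_one_two (f : L2Space d) : dilationOp (1 : GL (Fin d) ℝ) 2 f = -f := by
  apply Lp.ext
  refine (weightedComp_ae _ _ _ _ _ _ _ f).trans ?_
  filter_upwards [Lp.coeFn_neg f] with x hx
  rw [hx]
  have : linHomeo (1 : GL (Fin d) ℝ) x = x := by simp [linHomeo]
  rw [this]
  simp [zpow_ofNat]

end SymplecticGeneration

/-! ### Ladder relations for the Hermite functions -/

section HermiteLadder

variable {d : ℕ}

/-- Differentiating the recursion and inserting the induction hypothesis reproduces the recursion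
one level lower. This converts the derivative recursion into a three-term recurrence. -/
theorem derivative_hermitePoly_succ (n : ℕ) :
    Polynomial.derivative (hermitePoly (n + 1)) = 2 * ((n : Polynomial ℝ) + 1) * hermitePoly n := by
  induction n with
  | zero => simp [hermitePoly]
  | succ n ih =>
    have h : hermitePoly (n + 2) =
      2 * Polynomial.X * hermitePoly (n + 1) - Polynomial.derivative (hermitePoly (n + 1)) := rfl
    rw [h, Polynomial.derivative_sub, Polynomial.derivative_mul (f := 2 * Polynomial.X), ih]
    have h1 : hermitePoly (n + 1) =
      2 * Polynomial.X * hermitePoly n - Polynomial.derivative (hermitePoly n) := rfl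
    have h2 : Polynomial.derivative (2 * ((n : Polynomial ℝ) + 1)) = 0 := by simp
    have h3 : Polynomial.derivative (2 * Polynomial.X : Polynomial ℝ) = 2 := by simp
    rw [Polynomial.derivative_mul (f := 2 * ((n : Polynomial ℝ) + 1)), h2, h3]
    push_cast
    linear_combination (-2 * ((n : Polynomial ℝ) + 1)) * h1

/-- The factor `√(2(n+1))` is the ratio of consecutive normalisations. Clearing it puts levels `n`
and `n + 1` over one denominator. -/
theorem hermiteFun1_succ_eq (n : ℕ) (t : ℝ) :
    Real.sqrt (2 * (n + 1)) * hermiteFun1 (n + 1) t =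
      (hermitePoly (n + 1)).eval t / (Real.sqrt (2 ^ n * n.factorial) * Real.pi ^ (1 / 4 : ℝ)) *
        Real.exp (-t ^ 2 / 2) := by
  have h : Real.sqrt (2 ^ (n + 1) * (n + 1).factorial) =
      Real.sqrt (2 * (n + 1)) * Real.sqrt (2 ^ n * n.factorial) := by
    rw [← Real.sqrt_mul (by positivity), Nat.factorial_succ]
    congr 1; push_cast; ring
  have h1 : 0 < Real.sqrt (2 * (n + 1)) := by positivity
  rw [hermiteFun1, h]
  field_simp

/-- The product rule gives `H_n' - tH_n` times the Gaussian, and the defining recursion rewrites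
this as `tH_n - H_{n+1}`. This is the raising relation in one variable. -/
theorem hasDerivAt_hermiteFun1 (n : ℕ) (t : ℝ) :
    HasDerivAt (hermiteFun1 n) (t * hermiteFun1 n t -
      Real.sqrt (2 * (n + 1)) * hermiteFun1 (n + 1) t) t := by
  rw [hermiteFun1_succ_eq]
  have h1 : HasDerivAt (fun t : ℝ => Real.exp (-t ^ 2 / 2)) (Real.exp (-t ^ 2 / 2) * (-t)) t := by
    refine (((hasDerivAt_pow 2 t).fun_neg.div_const 2).exp).congr_deriv ?_
    push_cast
    ring
  have h2 := (((hermitePoly n).hasDerivAt t).div_const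
    (Real.sqrt (2 ^ n * n.factorial) * Real.pi ^ (1 / 4 : ℝ))).mul h1
  refine h2.congr_deriv ?_
  have h : (hermitePoly (n + 1)).eval t =
      2 * t * (hermitePoly n).eval t - (Polynomial.derivative (hermitePoly n)).eval t := by
    simp [hermitePoly]
  rw [h, hermiteFun1]
  ring

/-- The three-term recurrence in normalised form. Its left side is what `t + d/dt` produces on level
`n + 1`, so it yields the lowering relation. -/
theorem hermiteFun1_three_term (n : ℕ) (t : ℝ) :
    2 * t * hermiteFun1 (n + 1) t - Real.sqrt (2 * ((n + 1 : ℕ) + 1)) * hermiteFun1 (n + 2) t =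
      Real.sqrt (2 * (n + 1)) * hermiteFun1 n t := by
  rw [hermiteFun1_succ_eq (n + 1)]
  have h : (hermitePoly (n + 1 + 1)).eval t =
      2 * t * (hermitePoly (n + 1)).eval t - 2 * (n + 1) * (hermitePoly n).eval t := by
    rw [hermitePoly, Polynomial.eval_sub, derivative_hermitePoly_succ]
    simp
  have h2 : Real.sqrt (2 ^ (n + 1) * (n + 1).factorial) =
      Real.sqrt (2 * (n + 1)) * Real.sqrt (2 ^ n * n.factorial) := by
    rw [← Real.sqrt_mul (by positivity), Nat.factorial_succ]
    congr 1; push_cast; ring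
  have h3 : (2 * (n + 1) : ℝ) = Real.sqrt (2 * (n + 1)) ^ 2 := by
    rw [Real.sq_sqrt (by positivity)]
  have h1 : 0 < Real.sqrt (2 * (n + 1)) := by positivity
  rw [h, hermiteFun1, hermiteFun1, h2]
  generalize Real.sqrt (2 * (n + 1)) = s at *
  rw [h3]
  field_simp
  ring

/-- On a line in direction `e_j` only the `j`-th factor varies. Allowing a new index `k` in that
slot expresses `ψ_n`, its derivative and its neighbours `ψ_{n±e_j}` with the same cofactor. -/
theorem hermiteFunction_update {ħ : ℝ} (hħ : 0 < ħ) (n : Fin d → ℕ) (j : Fin d) (k : ℕ)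
    (x : Config d) (t : ℝ) :
    hermiteFunction hħ (Function.update n j k) (x + t • EuclideanSpace.single j (1 : ℝ)) =
      ((ħ ^ (-(d : ℝ) / 4) * ∏ i ∈ Finset.univ.erase j, hermiteFun1 (n i) (x i / Real.sqrt ħ) : ℝ)
        : ℂ) * (hermiteFun1 k ((x j + t) / Real.sqrt ħ) : ℝ) := by
  change ((ħ ^ (-(d : ℝ) / 4) * ∏ i, _ : ℝ) : ℂ) = _
  rw [← Finset.mul_prod_erase _ _ (Finset.mem_univ j), ← Complex.ofReal_mul]
  congr 1
  have : ∀ i ∈ Finset.univ.erase j, hermiteFun1 (Function.update n j k i)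
      ((x + t • EuclideanSpace.single j (1 : ℝ)) i / Real.sqrt ħ) =
      hermiteFun1 (n i) (x i / Real.sqrt ħ) := by
    intro i hi
    have hij := Finset.ne_of_mem_erase hi
    simp [hij]
  rw [Finset.prod_congr rfl this]
  simp
  ring

theorem momOp_hermiteFunction {ħ : ℝ} (hħ : 0 < ħ) (n : Fin d → ℕ) (j : Fin d) (x : Config d) :
    momOp ħ j (hermiteFunction hħ n) x = -(Complex.I * ħ) *
      (((ħ ^ (-(d : ℝ) / 4) * ∏ i ∈ Finset.univ.erase j, hermiteFun1 (n i) (x i / Real.sqrt ħ) : ℝ)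
        : ℂ) * (((x j / Real.sqrt ħ * hermiteFun1 (n j) (x j / Real.sqrt ħ) -
          Real.sqrt (2 * (n j + 1)) * hermiteFun1 (n j + 1) (x j / Real.sqrt ħ)) *
            (1 / Real.sqrt ħ) : ℝ) : ℂ)) := by
  rw [momOp_apply]
  congr 1
  have h0 : HasDerivAt (fun t : ℝ => (x j + t) / Real.sqrt ħ) (1 / Real.sqrt ħ) 0 :=
    ((hasDerivAt_id (0 : ℝ)).const_add _).div_const _
  have h1 := (HasDerivAt.comp (0 : ℝ) (h₂ := hermiteFun1 (n j))
    (h := fun t : ℝ => (x j + t) / Real.sqrt ħ) (hasDerivAt_hermiteFun1 (n j) _) h0).ofReal_comp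
  rw [add_zero] at h1
  refine HasDerivAt.deriv ((h1.const_mul _).congr_of_eventuallyEq (.of_forall fun t => ?_))
  have := hermiteFunction_update hħ n j (n j) x t
  rw [Function.update_eq_self] at this
  exact this

theorem hermiteFunction_update_self {ħ : ℝ} (hħ : 0 < ħ) (n : Fin d → ℕ) (j : Fin d) (k : ℕ)
    (x : Config d) :
    hermiteFunction hħ (Function.update n j k) x =
      ((ħ ^ (-(d : ℝ) / 4) * ∏ i ∈ Finset.univ.erase j, hermiteFun1 (n i) (x i / Real.sqrt ħ) : ℝ)
        : ℂ) * (hermiteFun1 k (x j / Real.sqrt ħ) : ℝ) := by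
  simpa using hermiteFunction_update hħ n j k x 0

theorem add_single_eq_update (n : Fin d → ℕ) (j : Fin d) (k : ℕ) :
    n + Pi.single j k = Function.update n j (n j + k) := by
  ext i
  by_cases h : i = j
  · subst h; simp
  · simp [h]

theorem hermiteRaise_hermiteFunction {ħ : ℝ} (hħ : 0 < ħ) (n : Fin d → ℕ) (j : Fin d) :
    hermiteRaise ħ j (hermiteFunction hħ n) =
      ((Real.sqrt (n j + 1) : ℝ) : ℂ) • hermiteFunction hħ (n + Pi.single j 1) := by
  ext x
  have e : hermiteRaise ħ j (hermiteFunction hħ n) x = ((Real.sqrt (2 * ħ) : ℂ))⁻¹ *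
    (posOp j (hermiteFunction hħ n) x - Complex.I * momOp ħ j (hermiteFunction hħ n) x) := rfl
  have e0 := hermiteFunction_update_self hħ n j (n j) x
  rw [Function.update_eq_self] at e0
  rw [e, momOp_hermiteFunction, posOp_apply, add_single_eq_update, _root_.smul_apply, smul_eq_mul,
    hermiteFunction_update_self, e0]
  generalize ħ ^ (-(d : ℝ) / 4) * ∏ i ∈ Finset.univ.erase j, _ = R
  have h2 : Real.sqrt (2 * ħ) = Real.sqrt 2 * Real.sqrt ħ := Real.sqrt_mul (by norm_num) _
  have h3 : Real.sqrt (2 * (n j + 1)) = Real.sqrt 2 * Real.sqrt (n j + 1) :=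
    Real.sqrt_mul (by norm_num) _
  have h4 : ħ = Real.sqrt ħ ^ 2 := (Real.sq_sqrt hħ.le).symm
  have h5 : 0 < Real.sqrt ħ := Real.sqrt_pos.mpr hħ
  have h6 : 0 < Real.sqrt 2 := by positivity
  rw [h2, h3]
  generalize hermiteFun1 (n j) _ = u
  generalize hermiteFun1 (n j + 1) _ = v
  generalize Real.sqrt (n j + 1) = w
  -- With `r = √2`, `s = √ħ` and `ħ = s²`, the claim becomes a rational identity modulo `i² = -1`.
  generalize Real.sqrt ħ = s at *
  generalize Real.sqrt 2 = r at *
  subst h4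
  have h5' : (s : ℂ) ≠ 0 := by exact_mod_cast h5.ne'
  have h6' : (r : ℂ) ≠ 0 := by exact_mod_cast h6.ne'
  push_cast
  field_simp
  linear_combination (R * u * x j - (s : ℂ) * r * w * v * R) * Complex.I_sq

/-- As `x̂ + ip̂ = x + ħ∂`, the derivative formula leaves twice the position term minus the level
above, and `hermiteFun1_three_term` collapses this to the level below. -/
theorem hermiteLower_hermiteFunction {ħ : ℝ} (hħ : 0 < ħ) (n : Fin d → ℕ) (j : Fin d)
    (hn : 1 ≤ n j) :
    hermiteLower ħ j (hermiteFunction hħ n) =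
      ((Real.sqrt (n j) : ℝ) : ℂ) • hermiteFunction hħ (n - Pi.single j 1) := by
  have hsub : n - Pi.single j 1 = Function.update n j (n j - 1) := by
    ext i
    by_cases h : i = j
    · subst h; simp
    · simp [h]
  obtain ⟨m, hm⟩ : ∃ m, n j = m + 1 := ⟨n j - 1, by omega⟩
  ext x
  have e : hermiteLower ħ j (hermiteFunction hħ n) x = ((Real.sqrt (2 * ħ) : ℂ))⁻¹ *
    (posOp j (hermiteFunction hħ n) x + Complex.I * momOp ħ j (hermiteFunction hħ n) x) := rfl
  have e0 := hermiteFunction_update_self hħ n j (n j) x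
  rw [Function.update_eq_self] at e0
  rw [e, momOp_hermiteFunction, posOp_apply, hsub, _root_.smul_apply, smul_eq_mul,
    hermiteFunction_update_self, e0, hm, Nat.add_sub_cancel]
  have h7 := hermiteFun1_three_term m (x j / Real.sqrt ħ)
  generalize ħ ^ (-(d : ℝ) / 4) * ∏ i ∈ Finset.univ.erase j, _ = R
  have h2 : Real.sqrt (2 * ħ) = Real.sqrt 2 * Real.sqrt ħ := Real.sqrt_mul (by norm_num) _
  have h3 : Real.sqrt (2 * (m + 1)) = Real.sqrt 2 * Real.sqrt ((m + 1 : ℕ)) := by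
    rw [Nat.cast_succ]; exact Real.sqrt_mul (by norm_num) _
  have h4 : ħ = Real.sqrt ħ ^ 2 := (Real.sq_sqrt hħ.le).symm
  have h5 : 0 < Real.sqrt ħ := Real.sqrt_pos.mpr hħ
  have h6 : 0 < Real.sqrt 2 := by positivity
  have h8 : Real.sqrt 2 ^ 2 = 2 := by norm_num
  rw [h3] at h7
  rw [h2]
  generalize Real.sqrt (2 * ((m + 1 : ℕ) + 1)) * hermiteFun1 (m + 1 + 1) _ = v at *
  generalize hermiteFun1 (m + 1) _ = u at *
  generalize hermiteFun1 m _ = u' at *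
  generalize Real.sqrt ((m + 1 : ℕ)) = w at *
  generalize Real.sqrt ħ = s at *
  generalize Real.sqrt 2 = r at *
  subst h4
  have h5' : (s : ℂ) ≠ 0 := by exact_mod_cast h5.ne'
  have h6' : (r : ℂ) ≠ 0 := by exact_mod_cast h6.ne'
  have h7' : 2 * (x j / s : ℂ) * u - v = r * w * u' := by exact_mod_cast congrArg Complex.ofReal h7
  rw [sub_eq_iff_eq_add] at h7'
  push_cast
  field_simp at h7' ⊢
  linear_combination (R : ℂ) * h7' - R * (u * x j - s * v) * Complex.I_sq

/-- Raising slot `j` from `0` to `k` collects the factors `√1, …, √k`, hence `√(k!)`. The powers act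
one slot at a time, from the right, so no commutation of the operators is used. -/
theorem prod_ofFn_pow_apply {E : Type*} [AddCommGroup E] [Module ℂ E] [TopologicalSpace E]
    [IsTopologicalAddGroup E] [ContinuousConstSMul ℂ E]
    (ψ : (Fin d → ℕ) → E) (a : Fin d → E →L[ℂ] E)
    (h : ∀ n j, a j (ψ n) = ((Real.sqrt (n j + 1) : ℝ) : ℂ) • ψ (n + Pi.single j 1))
    (n : Fin d → ℕ) :
    (List.ofFn fun j => a j ^ n j).prod (ψ 0) =
      ((Real.sqrt (∏ j, ((n j).factorial : ℝ)) : ℝ) : ℂ) • ψ n := by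
  have hpow : ∀ (j : Fin d) (m : Fin d → ℕ) (k : ℕ), m j = 0 → (a j ^ k) (ψ m) =
      ((Real.sqrt k.factorial : ℝ) : ℂ) • ψ (Function.update m j k) := by
    intro j m k hm
    induction k with
    | zero =>
      have : Function.update m j 0 = m := by rw [← hm, Function.update_eq_self]
      simp [this]
    | succ k ih =>
      rw [pow_succ', mul_apply_eq_comp, ih, map_smul, h, smul_smul,
        add_single_eq_update, ← Complex.ofReal_mul, ← Real.sqrt_mul (by positivity)]
      simp [Nat.factorial_succ, mul_comm]
  -- After the operators indexed by `l` have acted, exactly the slots in `l` are filled. Absence of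
  -- duplicates ensures that the next slot is still `0`, as `hpow` requires.
  have hl : ∀ l : List (Fin d), l.Nodup → (l.map fun j => a j ^ n j).prod (ψ 0) =
      ((Real.sqrt ((l.map fun j => ((n j).factorial : ℝ)).prod) : ℝ) : ℂ) •
        ψ (fun i => if i ∈ l then n i else 0) := by
    intro l hl
    induction l with
    | nil => simp; rfl
    | cons j l ih =>
      rw [List.nodup_cons] at hl
      rw [List.map_cons, List.prod_cons, mul_apply_eq_comp, ih hl.2, map_smul,
        hpow j _ _ (by simp [hl.1]), smul_smul, ← Complex.ofReal_mul, mul_comm,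
        ← Real.sqrt_mul (by positivity), List.map_cons, List.prod_cons]
      congr 2
      ext i
      by_cases hi : i = j
      · subst hi; simp
      · simp [hi]
  have := hl (List.finRange d) (List.nodup_finRange d)
  rw [← List.ofFn_eq_map] at this
  rw [this, ← List.ofFn_eq_map, List.prod_ofFn]
  simp

end HermiteLadder

/-! ### Symplectic covariance of position and momentum under metaplectic operators -/

section Covariance

variable {d : ℕ}

theorem map_ofReal_mul (M N : Matrix (Fin d) (Fin d) ℝ) :
    (M * N).map Complex.ofReal = M.map Complex.ofReal * N.map Complex.ofReal :=
  Matrix.map_mul (f := Complex.ofRealHom)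

theorem map_ofReal_one : (1 : Matrix (Fin d) (Fin d) ℝ).map Complex.ofReal = 1 :=
  Matrix.map_one _ Complex.ofReal_zero Complex.ofReal_one

theorem map_ofReal_zero : (0 : Matrix (Fin d) (Fin d) ℝ).map Complex.ofReal = 0 :=
  Matrix.map_zero _ Complex.ofReal_zero

theorem map_ofReal_mul_map_ofReal_inv (L : GL (Fin d) ℝ) :
    (L : Matrix (Fin d) (Fin d) ℝ).map Complex.ofReal *
      ((L⁻¹ : GL (Fin d) ℝ) : Matrix (Fin d) (Fin d) ℝ).map Complex.ofReal = 1 := by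
  rw [← map_ofReal_mul, ← Units.val_mul, mul_inv_cancel, Units.val_one, map_ofReal_one]

/-- The complexification of a real symplectic matrix. -/
def cmat (S : Sp d) : Matrix (Fin d ⊕ Fin d) (Fin d ⊕ Fin d) ℂ := S.1.map Complex.ofReal

theorem cmat_mul (S S' : Sp d) : cmat (S * S') = cmat S * cmat S' :=
  Matrix.map_mul (f := Complex.ofRealHom)

theorem cmat_one : cmat (1 : Sp d) = 1 :=
  Matrix.map_one _ Complex.ofReal_zero Complex.ofReal_one

/-- The operator `v·x̂ - u·p̂` attached to the vector `w = (u, v)` of the complexified phase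
space. -/
def phaseSpaceOp (ħ : ℝ) (w : Fin d ⊕ Fin d → ℂ) : 𝓢(Config d, ℂ) →L[ℂ] 𝓢(Config d, ℂ) :=
  ∑ k, (w (Sum.inr k) • posOp k - w (Sum.inl k) • momOp ħ k)

theorem phaseSpaceOp_def (ħ : ℝ) (w : Fin d ⊕ Fin d → ℂ) (f : 𝓢(Config d, ℂ)) :
    phaseSpaceOp ħ w f =
      ∑ k, (w (Sum.inr k) • posOp k f - w (Sum.inl k) • momOp ħ k f) := by
  simp [phaseSpaceOp]

theorem schwartz_sum_apply {ι : Type*} (s : Finset ι) (f : ι → 𝓢(Config d, ℂ)) (x : Config d) :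
    (∑ i ∈ s, f i) x = ∑ i ∈ s, f i x := by
  classical
  induction s using Finset.induction_on with
  | empty => simp
  | insert a s ha ih => rw [Finset.sum_insert ha, Finset.sum_insert ha, _root_.add_apply, ih]

theorem momOp_apply_fderiv (ħ : ℝ) (k : Fin d) (f : 𝓢(Config d, ℂ)) (x : Config d) :
    momOp ħ k f x = -(Complex.I * ħ) * fderiv ℝ f x (EuclideanSpace.single k 1) := by
  rw [momOp_apply, f.differentiableAt.lineDeriv_eq_fderiv]

theorem phaseSpaceOp_apply (ħ : ℝ) (w : Fin d ⊕ Fin d → ℂ) (f : 𝓢(Config d, ℂ)) (x : Config d) :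
    phaseSpaceOp ħ w f x = (∑ k, w (Sum.inr k) * x k) * f x +
      Complex.I * ħ * ∑ k, w (Sum.inl k) * fderiv ℝ f x (EuclideanSpace.single k 1) := by
  rw [phaseSpaceOp_def, schwartz_sum_apply, Finset.sum_mul, Finset.mul_sum,
    ← Finset.sum_add_distrib]
  refine Finset.sum_congr rfl fun k _ => ?_
  rw [_root_.sub_apply, _root_.smul_apply, _root_.smul_apply, posOp_apply, momOp_apply_fderiv]
  simp only [smul_eq_mul]
  ring

/-- A Schwartz function, as an element of `L²`. -/
abbrev toL2 (f : 𝓢(Config d, ℂ)) : L2Space d := f.toLp 2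

theorem toLp_injective {f g : 𝓢(Config d, ℂ)} (h : toL2 f = toL2 g) : f = g :=
  SchwartzMap.injective_toLp 2 volume h

theorem toLp_smul (c : ℂ) (f : 𝓢(Config d, ℂ)) : toL2 (c • f) = c • toL2 f :=
  map_smul (SchwartzMap.toLpCLM ℂ ℂ 2 (volume : Measure (Config d))) c f

theorem toLp_eq_of_ae (F : L2Space d) (g : 𝓢(Config d, ℂ)) (h : F =ᵐ[volume] g) :
    F = toL2 g :=
  Lp.ext (h.trans (g.coeFn_toLp 2 volume).symm)

theorem weightedComp_toLp (g : Config d → ℂ) (e : Config d ≃ₜ Config d) (K : ℝ≥0∞)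
    (hg : Continuous g) (hK0 : K ≠ 0) (hK : ∀ x, ‖g x‖ₑ ^ 2 = K)
    (hmap : K • (volume : Measure (Config d)).map e = volume) (f h : 𝓢(Config d, ℂ))
    (hfh : ∀ x, h x = g x * f (e x)) :
    weightedComp g e K hg hK0 hK hmap (toL2 f) = toL2 h := by
  refine toLp_eq_of_ae _ _ ((weightedComp_ae _ _ _ _ _ _ _ _).trans ?_)
  have hae : ∀ᵐ x : Config d, f.toLp 2 volume x = f x := f.coeFn_toLp 2 volume
  filter_upwards [(quasi_of_map_smul e K hK0 hmap).ae hae] with x hx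
  rw [hx, hfh]

theorem isometry_mul_apply (T T' : L2Space d ≃ₗᵢ[ℂ] L2Space d) (f : L2Space d) :
    (T * T') f = T (T' f) := rfl

/-- Symplectic covariance: `T` preserves the Schwartz space, and conjugation by `T` transforms
position and momentum by `S`. -/
structure IsCovariant (ħ : ℝ) (T : L2Space d ≃ₗᵢ[ℂ] L2Space d) (S : Sp d) : Prop where
  map : ∀ f : 𝓢(Config d, ℂ), ∃ g : 𝓢(Config d, ℂ), T (toL2 f) = toL2 g
  -- This clause makes the property pass to inverses: it says that `T⁻¹` preserves the Schwartz
  -- space too.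
  surj : ∀ g : 𝓢(Config d, ℂ), ∃ f : 𝓢(Config d, ℂ), T (toL2 f) = toL2 g
  cov : ∀ f g : 𝓢(Config d, ℂ), T (toL2 f) = toL2 g → ∀ w,
    T (toL2 (phaseSpaceOp ħ w f)) = toL2 (phaseSpaceOp ħ (cmat S *ᵥ w) g)

/-- Generators act on Schwartz functions by explicit formulas `τ`. As the Schwartz space embeds in
`L²`, covariance can be verified on `τ` pointwise. -/
theorem IsCovariant.of_map {ħ : ℝ} {T : L2Space d ≃ₗᵢ[ℂ] L2Space d} {S : Sp d}
    (τ : 𝓢(Config d, ℂ) → 𝓢(Config d, ℂ)) (hτ : ∀ f, T (toL2 f) = toL2 (τ f))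
    (hsurj : Function.Surjective τ)
    (hcov : ∀ f w, τ (phaseSpaceOp ħ w f) = phaseSpaceOp ħ (cmat S *ᵥ w) (τ f)) :
    IsCovariant ħ T S where
  map f := ⟨τ f, hτ f⟩
  surj g := by
    obtain ⟨f, rfl⟩ := hsurj g
    exact ⟨f, hτ f⟩
  cov f g h w := by
    have : g = τ f := toLp_injective (h.symm.trans (hτ f))
    rw [this, hτ, hcov]

theorem IsCovariant.one (ħ : ℝ) : IsCovariant ħ (1 : L2Space d ≃ₗᵢ[ℂ] L2Space d) (1 : Sp d) :=
  .of_map id (fun _ => rfl) Function.surjective_id fun f w => by simp [cmat_one]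

theorem IsCovariant.mul {ħ : ℝ} {T T' : L2Space d ≃ₗᵢ[ℂ] L2Space d} {S S' : Sp d}
    (h : IsCovariant ħ T S) (h' : IsCovariant ħ T' S') : IsCovariant ħ (T * T') (S * S') where
  map f := by
    obtain ⟨g, hg⟩ := h'.map f
    obtain ⟨k, hk⟩ := h.map g
    exact ⟨k, by rw [isometry_mul_apply, hg, hk]⟩
  surj k := by
    obtain ⟨g, hg⟩ := h.surj k
    obtain ⟨f, hf⟩ := h'.surj g
    exact ⟨f, by rw [isometry_mul_apply, hf, hg]⟩
  cov f k hk w := by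
    obtain ⟨g, hg⟩ := h'.map f
    rw [isometry_mul_apply, hg] at hk
    rw [isometry_mul_apply, h'.cov f g hg, h.cov g k hk, mulVec_mulVec, cmat_mul]

theorem IsCovariant.inv {ħ : ℝ} {T : L2Space d ≃ₗᵢ[ℂ] L2Space d} {S : Sp d}
    (h : IsCovariant ħ T S) : IsCovariant ħ T⁻¹ S⁻¹ where
  map f := by
    obtain ⟨g, hg⟩ := h.surj f
    exact ⟨g, (LinearIsometryEquiv.symm_apply_eq T).mpr hg.symm⟩
  surj f := by
    obtain ⟨g, hg⟩ := h.map f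
    exact ⟨g, (LinearIsometryEquiv.symm_apply_eq T).mpr hg.symm⟩
  cov f g hg w := by
    have hg' : T (toL2 g) = toL2 f := ((LinearIsometryEquiv.symm_apply_eq T).mp hg).symm
    -- Covariance of `T` at the vector `S⁻¹w` is covariance of `T⁻¹` at `w`, read backwards.
    have := h.cov g f hg' (cmat S⁻¹ *ᵥ w)
    rw [mulVec_mulVec, ← cmat_mul, mul_inv_cancel, cmat_one, one_mulVec] at this
    exact (LinearIsometryEquiv.symm_apply_eq T).mpr this.symm

/-- A derivative of `exp ∘ P` is bounded by `e^{Re P}` times a polynomial bound from the derivatives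
of `P`. It makes chirps and plane waves, whose exponents are imaginary, multipliers of the Schwartz
space. -/
theorem hasTemperateGrowth_cexp {P : Config d → ℂ} (hP : P.HasTemperateGrowth) {C : ℝ}
    (hre : ∀ x, (P x).re ≤ C) : (fun x => Complex.exp (P x)).HasTemperateGrowth := by
  refine ⟨(Complex.contDiff_exp).comp hP.1, fun n => ?_⟩
  obtain ⟨K, D, hD, hb⟩ := hP.norm_iteratedFDeriv_le_uniform n
  refine ⟨K * n, n.factorial * Real.exp C * (1 + D) ^ n, fun x => ?_⟩
  have h1 : ‖iteratedFDeriv ℝ n (fun x => Complex.exp (P x)) x‖ ≤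
      n.factorial * Real.exp (P x).re * ((1 + D) * (1 + ‖x‖) ^ K) ^ n := by
    refine norm_iteratedFDeriv_comp_le (N := (⊤ : ℕ∞)) (g := Complex.exp) (f := P)
      (Complex.contDiff_exp) hP.1 (mod_cast le_top) x
      (fun i _ => norm_iteratedFDeriv_cexp_le i (P x)) ?_
    intro i hi hi'
    calc _ ≤ D * (1 + ‖x‖) ^ K := hb i hi' x
      _ ≤ (1 + D) * (1 + ‖x‖) ^ K := by gcongr; simp
      _ ≤ _ := by
        apply le_self_pow₀ (one_le_mul_of_one_le_of_one_le (by simp [hD]) (by simp [one_le_pow₀]))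
        lia
  refine h1.trans ?_
  calc _ ≤ n.factorial * Real.exp C * ((1 + D) * (1 + ‖x‖) ^ K) ^ n := by
        gcongr
        exact hre x
    _ = _ := by rw [mul_pow, ← pow_mul]; ring

/-! ### Chirps -/

/-- The phase function of the chirp operator. -/
def chirpPhase (ħ : ℝ) (R : Matrix (Fin d) (Fin d) ℝ) (x : Config d) : ℂ :=
  Complex.exp (Complex.I * (((2 * ħ)⁻¹ * (x.ofLp ⬝ᵥ R *ᵥ x.ofLp) : ℝ) : ℂ))

theorem hasTemperateGrowth_chirpPhase (ħ : ℝ) (R : Matrix (Fin d) (Fin d) ℝ) :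
    (chirpPhase ħ R).HasTemperateGrowth := by
  refine hasTemperateGrowth_cexp (C := 0) ?_ fun x => by simp
  have : (fun x : Config d => Complex.I * (((2 * ħ)⁻¹ * (x.ofLp ⬝ᵥ R *ᵥ x.ofLp) : ℝ) : ℂ)) =
      fun x => Complex.I * (2 * ħ : ℂ)⁻¹ * ∑ i, (x i : ℂ) * ∑ j, (R i j : ℂ) * (x j : ℂ) := by
    funext x
    simp only [dotProduct, mulVec]
    push_cast
    ring
  rw [this]
  exact (Function.HasTemperateGrowth.const _).mul (.sum fun i _ => (hasTemperateGrowth_coord i).mul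
    (.sum fun j _ => (Function.HasTemperateGrowth.const _).mul (hasTemperateGrowth_coord j)))

/-- Along a coordinate line the exponent is quadratic in `t`. Symmetry of `R` merges the two cross
terms into `2(Rx)_k`. -/
theorem lineDeriv_chirpPhase {ħ : ℝ} (hħ : 0 < ħ) (R : Matrix (Fin d) (Fin d) ℝ) (hR : R.IsSymm)
    (x : Config d) (k : Fin d) :
    HasLineDerivAt ℝ (chirpPhase ħ R)
      (Complex.I / ħ * ((R *ᵥ x.ofLp) k : ℝ) * chirpPhase ħ R x) x
      (EuclideanSpace.single k 1) := by
  have hq : ∀ t : ℝ, (x + t • EuclideanSpace.single k (1 : ℝ)).ofLp ⬝ᵥ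
      R *ᵥ (x + t • EuclideanSpace.single k (1 : ℝ)).ofLp =
      x.ofLp ⬝ᵥ R *ᵥ x.ofLp + 2 * (R *ᵥ x.ofLp) k * t + R k k * t ^ 2 := by
    intro t
    have h1 : x.ofLp ⬝ᵥ R *ᵥ Pi.single k 1 = (R *ᵥ x.ofLp) k := by
      rw [dotProduct_mulVec, ← mulVec_transpose, hR.eq]
      simp
    simp only [WithLp.ofLp_add, WithLp.ofLp_smul, PiLp.ofLp_single, mulVec_add, mulVec_smul,
      dotProduct_add, add_dotProduct, smul_dotProduct, dotProduct_smul, h1, smul_eq_mul]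
    simp
    ring
  have h0 : HasDerivAt (fun t : ℝ => x.ofLp ⬝ᵥ R *ᵥ x.ofLp + 2 * (R *ᵥ x.ofLp) k * t
      + R k k * t ^ 2) (2 * (R *ᵥ x.ofLp) k) 0 := by
    have := (((hasDerivAt_id (0 : ℝ)).const_mul (2 * (R *ᵥ x.ofLp) k)).const_add
      (x.ofLp ⬝ᵥ R *ᵥ x.ofLp)).add ((hasDerivAt_pow 2 (0 : ℝ)).const_mul (R k k))
    refine this.congr_deriv ?_
    simp
  have h1 := (((h0.const_mul (2 * ħ)⁻¹).ofReal_comp).const_mul Complex.I).cexp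
  unfold HasLineDerivAt chirpPhase
  simp only [hq]
  refine h1.congr_deriv ?_
  have : (ħ : ℂ) ≠ 0 := by exact_mod_cast hħ.ne'
  push_cast
  simp
  field_simp

theorem fderiv_smulLeftCLM {E : Config d → ℂ} (hE : E.HasTemperateGrowth) {E' : ℂ}
    {x v : Config d} (h : HasLineDerivAt ℝ E E' x v) (f : 𝓢(Config d, ℂ)) :
    fderiv ℝ (SchwartzMap.smulLeftCLM ℂ E f) x v = E x * fderiv ℝ f x v + E' * f x := by
  rw [← (SchwartzMap.smulLeftCLM ℂ E f).differentiableAt.lineDeriv_eq_fderiv]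
  refine HasLineDerivAt.lineDeriv ?_
  have h2 : HasLineDerivAt ℝ f (fderiv ℝ f x v) x v := f.differentiableAt.hasFDerivAt.hasLineDerivAt v
  unfold HasLineDerivAt at h h2 ⊢
  have := h.mul h2
  simp only [zero_smul, add_zero] at this
  refine (this.congr_deriv (add_comm _ _)).congr_of_eventuallyEq (.of_forall fun t => ?_)
  simp [SchwartzMap.smulLeftCLM_apply_apply hE]

/-- A chirp commutes with `x̂` and conjugates `p̂` to `p̂ - Rx̂`, so `(u, v)` becomes `(u, v + Ru)`.
-/
theorem isCovariant_chirpOp {ħ : ℝ} (hħ : 0 < ħ) (R : Matrix (Fin d) (Fin d) ℝ) (hR : R.IsSymm) :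
    IsCovariant ħ (chirpOp ħ R) (spV R hR) := by
  have hg := hasTemperateGrowth_chirpPhase ħ R
  have hg' := hasTemperateGrowth_chirpPhase ħ (-R)
  refine .of_map (SchwartzMap.smulLeftCLM ℂ (chirpPhase ħ R)) (fun f => ?_) (fun g => ?_)
    (fun f w => ?_)
  · refine weightedComp_toLp _ _ _ _ _ _ _ _ _ fun x => ?_
    simp only [SchwartzMap.smulLeftCLM_apply_apply hg, smul_eq_mul]
    rfl
  · refine ⟨SchwartzMap.smulLeftCLM ℂ (chirpPhase ħ (-R)) g, ?_⟩
    ext x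
    rw [SchwartzMap.smulLeftCLM_apply_apply hg, SchwartzMap.smulLeftCLM_apply_apply hg',
      smul_smul, chirpPhase, chirpPhase, smul_eq_mul, ← Complex.exp_add]
    simp [neg_mulVec]
  · have hS : cmat (spV R hR) *ᵥ w = Sum.elim (w ∘ Sum.inl)
        (R.map Complex.ofReal *ᵥ (w ∘ Sum.inl) + w ∘ Sum.inr) := by
      change (fromBlocks 1 0 R 1).map Complex.ofReal *ᵥ w = _
      rw [fromBlocks_map, fromBlocks_mulVec, map_ofReal_one, map_ofReal_zero]
      simp
    ext x
    rw [SchwartzMap.smulLeftCLM_apply_apply hg, phaseSpaceOp_apply, phaseSpaceOp_apply, hS,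
      SchwartzMap.smulLeftCLM_apply_apply hg]
    simp only [fderiv_smulLeftCLM hg (lineDeriv_chirpPhase hħ R hR x _), Sum.elim_inl,
      Sum.elim_inr, Pi.add_apply, Function.comp_apply, smul_eq_mul]
    have hsymm : ∑ k, (R.map Complex.ofReal *ᵥ (w ∘ Sum.inl)) k * x k =
        ∑ k, w (Sum.inl k) * (((R *ᵥ x.ofLp) k : ℝ) : ℂ) := by
      simp only [mulVec, dotProduct, Finset.sum_mul, Complex.ofReal_sum, Finset.mul_sum]
      rw [Finset.sum_comm]
      refine Finset.sum_congr rfl fun i _ => Finset.sum_congr rfl fun j _ => ?_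
      rw [map_apply, ← hR.apply i j]
      simp only [Function.comp_apply]
      push_cast
      ring
    have hħ' : (ħ : ℂ) ≠ 0 := by exact_mod_cast hħ.ne'
    have e1 : ∀ k, w (Sum.inl k) * (chirpPhase ħ R x * fderiv ℝ f x (EuclideanSpace.single k 1) +
        Complex.I / ħ * ((R *ᵥ x.ofLp) k : ℝ) * chirpPhase ħ R x * f x) =
        chirpPhase ħ R x * (w (Sum.inl k) * fderiv ℝ f x (EuclideanSpace.single k 1)) +
        Complex.I / ħ * chirpPhase ħ R x * f x * (w (Sum.inl k) * ((R *ᵥ x.ofLp) k : ℝ)) :=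
      fun k => by ring
    simp only [e1, add_mul, Finset.sum_add_distrib, ← Finset.mul_sum, hsymm]
    generalize ∑ k, w (Sum.inl k) * (((R *ᵥ x.ofLp) k : ℝ) : ℂ) = a
    field_simp
    linear_combination (-a * f x * chirpPhase ħ R x) * Complex.I_sq

/-! ### Dilations -/

/-- The linear isomorphism `x ↦ L x` of `ℝ^d`. -/
def linCLE (L : GL (Fin d) ℝ) : Config d ≃L[ℝ] Config d where
  toFun := linHomeo L
  invFun := (linHomeo L).symm
  left_inv := (linHomeo L).left_inv
  right_inv := (linHomeo L).right_inv
  map_add' x y := by simp [linHomeo, mulVec_add]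
  map_smul' c x := by simp [linHomeo, mulVec_smul]
  continuous_toFun := (linHomeo L).continuous
  continuous_invFun := (linHomeo L).symm.continuous

/-- Composition with `L` conjugates `x̂` to `Lx̂` and, by the chain rule, `p̂` to `L⁻ᵀp̂`, so `(u,
v)` becomes `(L⁻¹u, Lᵀv)`. The scalar `c` matters only through `c ≠ 0`, so the parity of `m` plays
no role here. -/
theorem isCovariant_dilationOp (ħ : ℝ) (L : GL (Fin d) ℝ) (m : ℤ) :
    IsCovariant ħ (dilationOp L m) (spM L) := by
  set c : ℂ := Complex.I ^ m * (Real.sqrt |(L : Matrix (Fin d) (Fin d) ℝ).det| : ℂ) with hc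
  have hdet : (L : Matrix (Fin d) (Fin d) ℝ).det ≠ 0 :=
    ((Matrix.isUnit_iff_isUnit_det _).mp L.isUnit).ne_zero
  have hc0 : c ≠ 0 := mul_ne_zero (zpow_ne_zero _ Complex.I_ne_zero)
    (by simpa using (Real.sqrt_pos.mpr (abs_pos.mpr hdet)).ne')
  refine .of_map (fun f => c • SchwartzMap.compCLMOfContinuousLinearEquiv ℂ (linCLE L) f)
    (fun f => ?_) (fun g => ?_) (fun f w => ?_)
  · exact weightedComp_toLp _ _ _ _ _ _ _ _ _ fun x => rfl
  · refine ⟨c⁻¹ • SchwartzMap.compCLMOfContinuousLinearEquiv ℂ (linCLE L).symm g, ?_⟩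
    ext x
    simp [hc0]
  · have hS : cmat (spM L) *ᵥ w = Sum.elim
        ((((L⁻¹ : GL (Fin d) ℝ) : Matrix (Fin d) (Fin d) ℝ)).map Complex.ofReal *ᵥ (w ∘ Sum.inl))
        (((L : Matrix (Fin d) (Fin d) ℝ)ᵀ).map Complex.ofReal *ᵥ (w ∘ Sum.inr)) := by
      change (fromBlocks _ _ _ _).map Complex.ofReal *ᵥ w = _
      rw [fromBlocks_map, fromBlocks_mulVec, map_ofReal_zero]
      simp
    have hLL := map_ofReal_mul_map_ofReal_inv L
    have hfd : ∀ (x : Config d) (k : Fin d),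
        fderiv ℝ (c • SchwartzMap.compCLMOfContinuousLinearEquiv ℂ (linCLE L) f) x
          (EuclideanSpace.single k 1) =
        c * ∑ i, ((L : Matrix (Fin d) (Fin d) ℝ) i k : ℂ) *
          fderiv ℝ f (linHomeo L x) (EuclideanSpace.single i 1) := by
      intro x k
      have h1 : HasFDerivAt f (fderiv ℝ f (linCLE L x)) (linCLE L x) :=
        f.differentiableAt.hasFDerivAt
      have h2 := (h1.comp x (linCLE L).hasFDerivAt).const_smul c
      have h3 : linCLE L (EuclideanSpace.single k 1) = ∑ i,
          ((L : Matrix (Fin d) (Fin d) ℝ) i k) • EuclideanSpace.single i (1 : ℝ) := by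
        change linHomeo L _ = _
        ext i
        simp [linHomeo, Finset.sum_apply, Pi.single_apply]
      rw [show fderiv ℝ (⇑(c • SchwartzMap.compCLMOfContinuousLinearEquiv ℂ (linCLE L) f)) x = _
        from h2.fderiv]
      simp only [_root_.smul_apply, ContinuousLinearMap.comp_apply, ContinuousLinearEquiv.coe_coe,
        h3, map_sum, map_smul, smul_eq_mul, Complex.real_smul]
      rfl
    ext x
    rw [phaseSpaceOp_apply, hS]
    simp only [hfd, Sum.elim_inl, Sum.elim_inr]
    change c * phaseSpaceOp ħ w f (linHomeo L x) = _ * (c * f (linHomeo L x)) + _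
    rw [phaseSpaceOp_apply]
    have e1 : ∑ k, (((L : Matrix (Fin d) (Fin d) ℝ)ᵀ).map Complex.ofReal *ᵥ (w ∘ Sum.inr)) k * x k =
        ∑ k, w (Sum.inr k) * (linHomeo L x k : ℝ) := by
      simp only [mulVec, dotProduct, Finset.sum_mul, linHomeo, Finset.mul_sum, Complex.ofReal_sum,
        Homeomorph.homeomorph_mk_coe, Equiv.coe_fn_mk]
      rw [Finset.sum_comm]
      refine Finset.sum_congr rfl fun i _ => Finset.sum_congr rfl fun j _ => ?_
      simp
      ring
    have e2 : ∀ F : Fin d → ℂ, ∑ k, ((((L⁻¹ : GL (Fin d) ℝ) : Matrix (Fin d) (Fin d) ℝ)).map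
        Complex.ofReal *ᵥ (w ∘ Sum.inl)) k * (c * ∑ i, ((L : Matrix (Fin d) (Fin d) ℝ) i k : ℂ) *
          F i) = c * ∑ k, w (Sum.inl k) * F k := by
      intro F
      set u' := (((L⁻¹ : GL (Fin d) ℝ) : Matrix (Fin d) (Fin d) ℝ)).map
        Complex.ofReal *ᵥ (w ∘ Sum.inl) with hu'
      have hu : ∀ i, w (Sum.inl i) = ∑ k, ((L : Matrix (Fin d) (Fin d) ℝ) i k : ℂ) * u' k := by
        intro i
        have := congrFun (congrArg (· *ᵥ (w ∘ Sum.inl)) hLL) i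
        simp only [← mulVec_mulVec, ← hu', one_mulVec] at this
        exact this.symm
      simp only [hu, Finset.mul_sum, Finset.sum_mul]
      rw [Finset.sum_comm]
      refine Finset.sum_congr rfl fun i _ => Finset.sum_congr rfl fun j _ => ?_
      ring
    rw [e1, e2]
    ring

/-! ### The Fourier transform -/

/-- The linear isomorphism `x ↦ x / (2πħ)` of `ℝ^d`. -/
def scaleCLE {ħ : ℝ} (hħ : 0 < ħ) : Config d ≃L[ℝ] Config d :=
  ContinuousLinearEquiv.smulLeft (Units.mk0 ((2 * Real.pi * ħ)⁻¹ : ℝ) (by positivity))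

/-- The action of the operator `fourierOp` on Schwartz functions. -/
def schwartzFourierOp {ħ : ℝ} (hħ : 0 < ħ) (f : 𝓢(Config d, ℂ)) : 𝓢(Config d, ℂ) :=
  ((2 * Real.pi * ħ * Complex.I : ℂ) ^ ((d : ℂ) / 2))⁻¹ •
    SchwartzMap.compCLMOfContinuousLinearEquiv ℂ
      (scaleCLE hħ) (FourierTransform.fourier f)

theorem fourier_const_ne_zero {ħ : ℝ} (hħ : 0 < ħ) :
    (2 * Real.pi * ħ * Complex.I : ℂ) ^ ((d : ℂ) / 2) ≠ 0 := by
  have h1 : (2 * Real.pi * ħ * Complex.I : ℂ) ≠ 0 := by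
    simp [Real.pi_ne_zero, hħ.ne']
  simp [Complex.cpow_eq_zero_iff, h1]

theorem schwartzFourierOp_apply {ħ : ℝ} (hħ : 0 < ħ) (f : 𝓢(Config d, ℂ)) (x : Config d) :
    schwartzFourierOp hħ f x = ((2 * Real.pi * ħ * Complex.I : ℂ) ^ ((d : ℂ) / 2))⁻¹ *
      (FourierTransform.fourier f : 𝓢(Config d, ℂ)) ((2 * Real.pi * ħ)⁻¹ • x) := rfl

theorem fourierOp_toL2 {ħ : ℝ} (hħ : 0 < ħ) (f : 𝓢(Config d, ℂ)) :
    fourierOp hħ (toL2 f) = toL2 (schwartzFourierOp hħ f) := by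
  have hF : Lp.fourierTransformₗᵢ (Config d) ℂ (f.toLp 2) = (FourierTransform.fourier f).toLp 2 :=
    SchwartzMap.toLp_fourier_eq f
  simp only [fourierOp, LinearIsometryEquiv.trans_apply]
  rw [hF]
  exact weightedComp_toLp _ _ _ _ _ _ _ _ _ fun x => rfl

theorem schwartzFourierOp_surjective {ħ : ℝ} (hħ : 0 < ħ) :
    Function.Surjective (schwartzFourierOp (d := d) hħ) := by
  intro g
  have hc := fourier_const_ne_zero (d := d) hħ
  refine ⟨FourierTransformInv.fourierInv (((2 * Real.pi * ħ * Complex.I : ℂ) ^ ((d : ℂ) / 2)) •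
    SchwartzMap.compCLMOfContinuousLinearEquiv ℂ
      (scaleCLE hħ).symm g), ?_⟩
  rw [schwartzFourierOp, FourierTransform.fourier_fourierInv_eq]
  ext x
  simp [hc]

theorem smulLeftCLM_inner_single (k : Fin d) (f : 𝓢(Config d, ℂ)) :
    SchwartzMap.smulLeftCLM ℂ (inner ℝ · (EuclideanSpace.single k (1 : ℝ))) f = posOp k f := by
  ext x
  rw [SchwartzMap.smulLeftCLM_apply_apply (Function.hasTemperateGrowth_inner_left _), posOp_apply]
  simp [EuclideanSpace.inner_single_right]

/-- The factor `-2πi` from differentiating the Fourier transform meets the chain-rule factor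
`(2πħ)⁻¹` of the dilation. Their product `-i/ħ` is turned into `-1` by the `-iħ` in `p̂_k`. -/
theorem schwartzFourierOp_posOp {ħ : ℝ} (hħ : 0 < ħ) (f : 𝓢(Config d, ℂ)) (k : Fin d) :
    schwartzFourierOp hħ (posOp k f) = -momOp ħ k (schwartzFourierOp hħ f) := by
  have h := SchwartzMap.lineDerivOp_fourier_eq f (EuclideanSpace.single k (1 : ℝ))
  rw [smulLeftCLM_inner_single, FourierTransform.fourier_smul] at h
  have hħ' : (ħ : ℂ) ≠ 0 := by exact_mod_cast hħ.ne'
  have hpi : (Real.pi : ℂ) ≠ 0 := by exact_mod_cast Real.pi_ne_zero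
  rw [momOp, schwartzFourierOp, schwartzFourierOp, _root_.smul_apply,
    LineDeriv.lineDerivOpCLM_apply, LineDeriv.lineDerivOp_smul,
    SchwartzMap.lineDerivOp_compCLMOfContinuousLinearEquiv]
  have h1 : scaleCLE hħ (EuclideanSpace.single k (1 : ℝ)) =
      (2 * Real.pi * ħ)⁻¹ • EuclideanSpace.single k (1 : ℝ) := rfl
  rw [h1, LineDeriv.lineDerivOp_left_smul, h]
  ext x
  simp
  field_simp
  simp

theorem schwartzFourierOp_momOp {ħ : ℝ} (hħ : 0 < ħ) (f : 𝓢(Config d, ℂ)) (k : Fin d) :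
    schwartzFourierOp hħ (momOp ħ k f) = posOp k (schwartzFourierOp hħ f) := by
  have h := SchwartzMap.fourier_lineDerivOp_eq f (EuclideanSpace.single k (1 : ℝ))
  rw [smulLeftCLM_inner_single] at h
  have hħ' : (ħ : ℂ) ≠ 0 := by exact_mod_cast hħ.ne'
  have hpi : (Real.pi : ℂ) ≠ 0 := by exact_mod_cast Real.pi_ne_zero
  ext x
  rw [posOp_apply, schwartzFourierOp_apply, schwartzFourierOp_apply, momOp, _root_.smul_apply,
    LineDeriv.lineDerivOpCLM_apply, FourierTransform.fourier_smul, h, _root_.smul_apply,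
    _root_.smul_apply, posOp_apply]
  simp
  field_simp
  simp

/-- `x̂` goes to `-p̂` and `p̂` to `x̂`, so `v·x̂ - u·p̂` becomes `-u·x̂ - v·p̂`, the operator of
`(v, -u) = J(u, v)`. -/
theorem isCovariant_fourierOp {ħ : ℝ} (hħ : 0 < ħ) :
    IsCovariant ħ (fourierOp (d := d) hħ) spJ := by
  refine .of_map (schwartzFourierOp hħ) (fourierOp_toL2 hħ) (schwartzFourierOp_surjective hħ)
    fun f w => ?_
  have hS : cmat spJ *ᵥ w = Sum.elim (w ∘ Sum.inr) (-(w ∘ Sum.inl)) := by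
    change (fromBlocks 0 1 (-1) 0).map Complex.ofReal *ᵥ w = _
    have : (-1 : Matrix (Fin d) (Fin d) ℝ).map Complex.ofReal = -1 := by
      ext i j; simp [Matrix.one_apply, apply_ite Complex.ofReal]
    rw [fromBlocks_map, fromBlocks_mulVec, map_ofReal_one, map_ofReal_zero, this]
    rw [zero_mulVec, zero_mulVec, one_mulVec, zero_add, add_zero, neg_mulVec, one_mulVec]
  have hsum : ∀ F : Fin d → 𝓢(Config d, ℂ), schwartzFourierOp hħ (∑ k, F k) =
      ∑ k, schwartzFourierOp hħ (F k) := by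
    intro F
    simp only [schwartzFourierOp, ← FourierTransform.fourierCLM_apply (R := ℂ), map_sum,
      Finset.smul_sum]
  rw [phaseSpaceOp_def, phaseSpaceOp_def, hS, hsum]
  refine Finset.sum_congr rfl fun k _ => ?_
  have : schwartzFourierOp hħ (w (Sum.inr k) • posOp k f - w (Sum.inl k) • momOp ħ k f) =
      w (Sum.inr k) • schwartzFourierOp hħ (posOp k f) -
        w (Sum.inl k) • schwartzFourierOp hħ (momOp ħ k f) := by
    simp only [schwartzFourierOp, ← FourierTransform.fourierCLM_apply (R := ℂ), map_sub, map_smul,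
      smul_sub]
    rw [smul_comm _ (w (Sum.inr k)), smul_comm _ (w (Sum.inl k))]
  rw [this, schwartzFourierOp_posOp, schwartzFourierOp_momOp]
  simp
  abel

theorem IsMetaplecticOver.isCovariant {ħ : ℝ} {hħ : 0 < ħ} {T : L2Space d ≃ₗᵢ[ℂ] L2Space d}
    {S : Sp d} (h : IsMetaplecticOver hħ T S) : IsCovariant ħ T S := by
  refine Subgroup.closure_induction (p := fun x _ => IsCovariant ħ x.1 x.2) ?_ (.one ħ)
    (fun _ _ _ _ h h' => h.mul h') (fun _ _ h => h.inv) h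
  rintro _ ((rfl | ⟨R, hR, rfl⟩) | ⟨L, m, -, rfl⟩)
  · exact isCovariant_fourierOp hħ
  · exact isCovariant_chirpOp hħ R hR
  · exact isCovariant_dilationOp ħ L m

end Covariance

/-! ### Complex Gaussian integrals -/

section GaussianIntegrals

variable {d : ℕ}

theorem exists_orthogonal_diagonal {Y : Matrix (Fin d) (Fin d) ℝ} (hY : Y.IsHermitian) :
    ∃ U : Matrix (Fin d) (Fin d) ℝ, Uᵀ * U = 1 ∧ Uᵀ * Y * U = diagonal hY.eigenvalues := by
  refine ⟨hY.eigenvectorUnitary, Unitary.coe_star_mul_self hY.eigenvectorUnitary, ?_⟩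
  have := hY.conjStarAlgAut_star_eigenvectorUnitary
  rw [Unitary.conjStarAlgAut_star_apply] at this
  exact this

/-- Simultaneous diagonalization by congruence of a positive definite and a symmetric matrix. -/
theorem exists_simultaneous_diagonal {X Y : Matrix (Fin d) (Fin d) ℝ} (hX : X.PosDef)
    (hY : Y.IsSymm) :
    ∃ (G : GL (Fin d) ℝ) (μ : Fin d → ℝ), G.valᵀ * X * G.val = 1 ∧
      G.valᵀ * Y * G.val = diagonal μ := by
  obtain ⟨U, hU, hUX⟩ := exists_orthogonal_diagonal hX.1
  set l := hX.1.eigenvalues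
  have hl : ∀ i, 0 < l i := fun i => hX.eigenvalues_pos i
  -- Rescaled eigenvectors of `X` bring it to the identity. A further orthogonal `W` diagonalises
  -- `VᵀYV` without disturbing this.
  let V := U * diagonal fun i => (Real.sqrt (l i))⁻¹
  have hV : Vᵀ * X * V = 1 := by
    have : Vᵀ * X * V = diagonal (fun i => (Real.sqrt (l i))⁻¹) * (Uᵀ * X * U) *
        diagonal (fun i => (Real.sqrt (l i))⁻¹) := by
      simp only [V, transpose_mul, diagonal_transpose, mul_assoc]
    rw [this, hUX, diagonal_mul_diagonal, diagonal_mul_diagonal, ← diagonal_one]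
    congr 1
    funext i
    have h1 : 0 < Real.sqrt (l i) := Real.sqrt_pos.mpr (hl i)
    have h2 := Real.sq_sqrt (hl i).le
    field_simp
    exact h2.symm
  have hVY : (Vᵀ * Y * V).IsHermitian := by
    change (Vᵀ * Y * V)ᵀ = _
    simp [transpose_mul, hY.eq, mul_assoc]
  obtain ⟨W, hW, hWY⟩ := exists_orthogonal_diagonal hVY
  have hG : (V * W)ᵀ * X * (V * W) = 1 := by
    calc (V * W)ᵀ * X * (V * W) = Wᵀ * (Vᵀ * X * V) * W := by
          simp only [transpose_mul, mul_assoc]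
      _ = 1 := by rw [hV, mul_one, hW]
  have hdet : (V * W).det ≠ 0 := by
    intro h
    have := congrArg det hG
    rw [det_mul, h, mul_zero, det_one] at this
    exact zero_ne_one this
  refine ⟨Matrix.GeneralLinearGroup.mkOfDetNeZero _ hdet, hVY.eigenvalues, hG, ?_⟩
  rw [← hWY]
  change (V * W)ᵀ * Y * (V * W) = _
  simp only [transpose_mul, mul_assoc]

theorem integral_comp_linHomeo (G : GL (Fin d) ℝ) (F : Config d → ℂ) :
    ∫ y, F y = (|G.val.det| : ℝ) * ∫ u, F (linHomeo G u) := by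
  conv_lhs => rw [← map_linHomeo G]
  rw [integral_smul_measure, (linHomeo G).measurableEmbedding.integral_map,
    ENNReal.toReal_ofReal (abs_nonneg _), Complex.real_smul]

theorem integral_cexp_diagonal {b : Fin d → ℂ} (hb : ∀ i, 0 < (b i).re) (c : Fin d → ℂ) :
    ∫ v : Config d, Complex.exp (-∑ i, b i * (v i : ℂ) ^ 2 + ∑ i, c i * v i) =
      (∏ i, (Real.pi / b i) ^ (1 / 2 : ℂ)) * Complex.exp (∑ i, c i ^ 2 / (4 * b i)) := by
  rw [← (PiLp.volume_preserving_toLp (Fin d)).integral_comp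
    (MeasurableEquiv.toLp 2 _).measurableEmbedding]
  rw [Complex.exp_sum, ← Finset.prod_mul_distrib]
  exact GaussianFourier.integral_cexp_neg_sum_mul_add hb c

/-- The Fourier transform of a complex Gaussian. The constant is determined up to sign. -/
theorem exists_integral_cexp_quadratic {N : Matrix (Fin d) (Fin d) ℂ} (hN : N.IsSymm)
    (hpos : (N.map Complex.re).PosDef) :
    ∃ κ : ℂ, κ ^ 2 * N.det = Real.pi ^ d ∧ ∀ (c : ℂ) (x : Config d),
      ∫ y : Config d, Complex.exp (-(cvec y ⬝ᵥ N *ᵥ cvec y) + c * (inner ℝ x y : ℝ)) =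
        κ * Complex.exp (c ^ 2 / 4 * (cvec x ⬝ᵥ N⁻¹ *ᵥ cvec x)) := by
  have hY : (N.map Complex.im).IsSymm := by
    rw [IsSymm, ← transpose_map, hN.eq]
  -- A real change of variables making `Re N` the identity and `Im N` diagonal turns `N` into
  -- `diag(1 + iμ)`, and the integral factors into one-dimensional ones.
  obtain ⟨G, μ, hGX, hGY⟩ := exists_simultaneous_diagonal hpos hY
  set g : Matrix (Fin d) (Fin d) ℂ := G.val.map Complex.ofReal with hg
  have hGdet : G.val.det ≠ 0 := ((Matrix.isUnit_iff_isUnit_det _).mp G.isUnit).ne_zero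
  have hgdet : g.det = (G.val.det : ℂ) := (RingHom.map_det Complex.ofRealHom G.val).symm
  have hgdet0 : g.det ≠ 0 := by rw [hgdet]; exact_mod_cast hGdet
  let b : Fin d → ℂ := fun i => 1 + Complex.I * μ i
  have hb : ∀ i, 0 < (b i).re := fun i => by simp [b]
  have hb0 : ∀ i, b i ≠ 0 := fun i h => by have := hb i; rw [h] at this; simp at this
  have hNsplit : N = (N.map Complex.re).map Complex.ofReal +
      Complex.I • (N.map Complex.im).map Complex.ofReal := by
    ext i j
    simp only [Matrix.add_apply, Matrix.smul_apply, Matrix.map_apply, smul_eq_mul]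
    rw [mul_comm, Complex.re_add_im]
  have hmap : ∀ M : Matrix (Fin d) (Fin d) ℝ, gᵀ * M.map Complex.ofReal * g =
      (G.valᵀ * M * G.val).map Complex.ofReal := by
    intro M
    rw [map_ofReal_mul, map_ofReal_mul]
    rfl
  have hdiag : gᵀ * N * g = diagonal b := by
    rw [hNsplit, mul_add, add_mul, mul_smul_comm, smul_mul_assoc, hmap, hmap, hGX, hGY]
    ext i j
    by_cases h : i = j
    · subst h; simp [b]
    · simp [h]
  have hNdet : g.det ^ 2 * N.det = ∏ i, b i := by
    have := congrArg det hdiag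
    rw [det_mul, det_mul, det_transpose, det_diagonal] at this
    rw [← this]; ring
  have hNinv : N⁻¹ = g * diagonal (fun i => (b i)⁻¹) * gᵀ := by
    have hd : diagonal (fun i => (b i)⁻¹) * diagonal b = 1 := by
      rw [diagonal_mul_diagonal, ← diagonal_one]
      congr 1
      funext i
      exact inv_mul_cancel₀ (hb0 i)
    refine Matrix.inv_eq_left_inv ?_
    have hgu : IsUnit g.det := hgdet0.isUnit
    calc g * diagonal (fun i => (b i)⁻¹) * gᵀ * N
        = g * diagonal (fun i => (b i)⁻¹) * (gᵀ * N * g) * g⁻¹ := by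
          simp only [mul_assoc]
          rw [mul_nonsing_inv _ hgu, mul_one]
      _ = 1 := by rw [hdiag, mul_assoc g, hd, mul_one, mul_nonsing_inv _ hgu]
  have hcv : ∀ u, cvec (linHomeo G u) = g *ᵥ cvec u := by
    intro u
    funext i
    simp [cvec, linHomeo, mulVec, dotProduct, hg]
  have hquad : ∀ u, cvec (linHomeo G u) ⬝ᵥ N *ᵥ cvec (linHomeo G u) =
      ∑ i, b i * (u i : ℂ) ^ 2 := by
    intro u
    rw [hcv, mulVec_mulVec, ← vecMul_transpose, ← dotProduct_mulVec, mulVec_mulVec, ← mul_assoc,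
      hdiag]
    simp only [dotProduct, mulVec_diagonal]
    exact Finset.sum_congr rfl fun i _ => by rw [cvec]; ring
  have hlin : ∀ (c : ℂ) (x u : Config d), c * (inner ℝ x (linHomeo G u) : ℝ) =
      ∑ i, (c * (gᵀ *ᵥ cvec x) i) * u i := by
    intro c x u
    have h1 : ((inner ℝ x (linHomeo G u) : ℝ) : ℂ) = cvec x ⬝ᵥ cvec (linHomeo G u) := by
      simp [PiLp.inner_apply, dotProduct, cvec, mul_comm]
    rw [h1, hcv, dotProduct_mulVec, ← mulVec_transpose, dotProduct, Finset.mul_sum]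
    exact Finset.sum_congr rfl fun i _ => by rw [cvec]; ring
  -- The Jacobian times the one-dimensional Gaussian constants. Recording only the square of `κ`
  -- avoids following the branch of `(det N)^{1/2}`.
  refine ⟨(|G.val.det| : ℝ) * ∏ i, (Real.pi / b i) ^ (1 / 2 : ℂ), ?_, fun c x => ?_⟩
  · rw [mul_pow, ← Finset.prod_pow]
    have h1 : ∀ i, ((Real.pi / b i : ℂ) ^ (1 / 2 : ℂ)) ^ 2 = Real.pi / b i := by
      intro i
      rw [← Complex.cpow_nat_mul]
      norm_num
    have h2 : ((|G.val.det| : ℝ) : ℂ) ^ 2 = g.det ^ 2 := by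
      rw [hgdet, ← Complex.ofReal_pow, ← Complex.ofReal_pow, sq_abs]
    simp only [h1]
    rw [h2, Finset.prod_div_distrib, mul_right_comm, hNdet, Finset.prod_const, Finset.card_univ,
      Fintype.card_fin, mul_div_cancel₀]
    exact Finset.prod_ne_zero_iff.mpr fun i _ => hb0 i
  · rw [integral_comp_linHomeo G]
    simp only [hquad, hlin]
    rw [integral_cexp_diagonal hb, mul_assoc]
    congr 3
    rw [hNinv, ← mulVec_mulVec, ← mulVec_mulVec, dotProduct_mulVec, ← mulVec_transpose, dotProduct,
      Finset.mul_sum]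
    refine Finset.sum_congr rfl fun i _ => ?_
    rw [mulVec_diagonal]
    have := hb0 i
    field_simp

end GaussianIntegrals

/-! ### Action of metaplectic operators on centred Gaussians -/

section GroundStates

variable {d : ℕ}

/-- The operator `T` over `S` maps centred Gaussian wave packets to centred Gaussian wave packets,
with the parameter transformed by `S`. -/
def TransformsGaussians {ħ : ℝ} (hħ : 0 < ħ) (T : L2Space d ≃ₗᵢ[ℂ] L2Space d) (S : Sp d) : Prop :=
  ∀ (S' : Sp d) (σ' : ℂ), σ' ^ 2 = (Qmat S').det → ∃ σ : ℂ, σ ^ 2 = (Qmat (S * S')).det ∧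
    T (toL2 (hagedornGround hħ S' 0 0 σ')) = toL2 (hagedornGround hħ (S * S') 0 0 σ)

theorem hagedornGround_neg {ħ : ℝ} (hħ : 0 < ħ) (S : Sp d) (q p : Config d) (σ : ℂ) :
    hagedornGround hħ S q p (-σ) = -hagedornGround hħ S q p σ := by
  ext x
  change (-σ)⁻¹ * _ * _ = -(σ⁻¹ * _ * _)
  rw [inv_neg]
  ring

theorem toL2_neg (f : 𝓢(Config d, ℂ)) : toL2 (-f) = -toL2 f :=
  map_neg (SchwartzMap.toLpCLM ℂ ℂ 2 (volume : Measure (Config d))) f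

theorem TransformsGaussians.one {ħ : ℝ} (hħ : 0 < ħ) :
    TransformsGaussians hħ (1 : L2Space d ≃ₗᵢ[ℂ] L2Space d) 1 :=
  fun S' σ' h => ⟨σ', by rw [one_mul, h], by rw [one_mul]; rfl⟩

theorem TransformsGaussians.mul {ħ : ℝ} {hħ : 0 < ħ} {T T' : L2Space d ≃ₗᵢ[ℂ] L2Space d}
    {S S' : Sp d} (h : TransformsGaussians hħ T S) (h' : TransformsGaussians hħ T' S') :
    TransformsGaussians hħ (T * T') (S * S') := by
  intro S₀ σ₀ h₀
  obtain ⟨σ₁, h₁, e₁⟩ := h' S₀ σ₀ h₀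
  obtain ⟨σ₂, h₂, e₂⟩ := h _ σ₁ h₁
  exact ⟨σ₂, by rw [h₂, mul_assoc], by rw [isometry_mul_apply, e₁, e₂, mul_assoc]⟩

/-- Any root chosen for the label `S⁻¹S₀` yields a Gaussian that `T` sends to the one labelled `S₀`
with root `±σ₀`. In the minus case the chosen root is negated. -/
theorem TransformsGaussians.inv {ħ : ℝ} {hħ : 0 < ħ} {T : L2Space d ≃ₗᵢ[ℂ] L2Space d}
    {S : Sp d} (h : TransformsGaussians hħ T S) : TransformsGaussians hħ T⁻¹ S⁻¹ := by
  intro S₀ σ₀ h₀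
  obtain ⟨σ, hσ⟩ := IsAlgClosed.exists_pow_nat_eq (Qmat (S⁻¹ * S₀)).det (n := 2) two_pos
  obtain ⟨σ₁, h₁, e₁⟩ := h _ σ hσ
  rw [mul_inv_cancel_left] at h₁ e₁
  rw [← h₀] at h₁
  rcases sq_eq_sq_iff_eq_or_eq_neg.mp h₁ with rfl | rfl
  · exact ⟨σ, hσ, (LinearIsometryEquiv.symm_apply_eq T).mpr e₁.symm⟩
  · refine ⟨-σ, by rw [neg_sq, hσ], (LinearIsometryEquiv.symm_apply_eq T).mpr ?_⟩
    rw [hagedornGround_neg, toL2_neg, map_neg, e₁, hagedornGround_neg, toL2_neg, neg_neg]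

/-- The stacked matrix `(Q; P)` is the symplectic matrix applied to `(I; iI)`, so left
multiplication acts on it linearly. `Pmat_mul` is the lower half. -/
theorem Qmat_mul (S S' : Sp d) : Qmat (S * S') =
    S.1.toBlocks₁₁.map Complex.ofReal * Qmat S' + S.1.toBlocks₁₂.map Complex.ofReal * Pmat S' := by
  have h : (S * S').1 = S.1 * S'.1 := rfl
  have hadd : ∀ M N : Matrix (Fin d) (Fin d) ℝ, (M + N).map Complex.ofReal =
      M.map Complex.ofReal + N.map Complex.ofReal := fun M N =>
    Matrix.map_add _ Complex.ofReal_add _ _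
  rw [Qmat, Qmat, Pmat, h, ← Matrix.fromBlocks_toBlocks S.1, ← Matrix.fromBlocks_toBlocks S'.1,
    fromBlocks_multiply]
  simp only [toBlocks_fromBlocks₁₁, toBlocks_fromBlocks₁₂, toBlocks_fromBlocks₂₁,
    toBlocks_fromBlocks₂₂, map_ofReal_mul, hadd, mul_add, smul_add, mul_smul_comm]
  abel

theorem Pmat_mul (S S' : Sp d) : Pmat (S * S') =
    S.1.toBlocks₂₁.map Complex.ofReal * Qmat S' + S.1.toBlocks₂₂.map Complex.ofReal * Pmat S' := by
  have h : (S * S').1 = S.1 * S'.1 := rfl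
  have hadd : ∀ M N : Matrix (Fin d) (Fin d) ℝ, (M + N).map Complex.ofReal =
      M.map Complex.ofReal + N.map Complex.ofReal := fun M N =>
    Matrix.map_add _ Complex.ofReal_add _ _
  rw [Pmat, Qmat, Pmat, h, ← Matrix.fromBlocks_toBlocks S.1, ← Matrix.fromBlocks_toBlocks S'.1,
    fromBlocks_multiply]
  simp only [toBlocks_fromBlocks₁₁, toBlocks_fromBlocks₁₂, toBlocks_fromBlocks₂₁,
    toBlocks_fromBlocks₂₂, map_ofReal_mul, hadd, mul_add, smul_add, mul_smul_comm]
  abel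

theorem hagedornGround_zero_apply {ħ : ℝ} (hħ : 0 < ħ) (S : Sp d) (σ : ℂ) (x : Config d) :
    hagedornGround hħ S 0 0 σ x = σ⁻¹ * ((Real.pi * ħ) ^ (-(d : ℝ) / 4) : ℝ) *
      Complex.exp (Complex.I / ħ * (1 / 2 * (cvec x ⬝ᵥ (Pmat S * (Qmat S)⁻¹) *ᵥ cvec x))) := by
  change _ * _ * Complex.exp (hagedornExponent ħ S 0 0 x) = _
  simp [hagedornExponent]

/-- The pair `(Q, P)` becomes `(Q, P + RQ)`: the chirp adds `R` to `PQ⁻¹` and leaves the root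
unchanged. -/
theorem transformsGaussians_chirpOp {ħ : ℝ} (hħ : 0 < ħ) (R : Matrix (Fin d) (Fin d) ℝ)
    (hR : R.IsSymm) : TransformsGaussians hħ (chirpOp ħ R) (spV R hR) := by
  intro S σ hσ
  have hQ : Qmat (spV R hR * S) = Qmat S := by
    rw [Qmat_mul]
    simp [spV]
  have hP : Pmat (spV R hR * S) = R.map Complex.ofReal * Qmat S + Pmat S := by
    rw [Pmat_mul]
    simp [spV]
  refine ⟨σ, by rw [hQ, hσ], weightedComp_toLp _ _ _ _ _ _ _ _ _ fun x => ?_⟩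
  rw [hagedornGround_zero_apply, Homeomorph.refl_apply, hagedornGround_zero_apply, hQ, hP,
    add_mul, mul_assoc (R.map _), mul_nonsing_inv _ (det_Qmat_ne_zero S).isUnit, mul_one,
    add_mulVec, dotProduct_add, mul_left_comm (Complex.exp _), ← Complex.exp_add]
  congr 2
  have : cvec x ⬝ᵥ R.map Complex.ofReal *ᵥ cvec x = ((x.ofLp ⬝ᵥ R *ᵥ x.ofLp : ℝ) : ℂ) := by
    simp [dotProduct, mulVec, cvec]
  rw [this]
  push_cast
  have : (ħ : ℂ) ≠ 0 := by exact_mod_cast hħ.ne'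
  field_simp
  rfl

/-- The substitution `x ↦ Lx` turns `PQ⁻¹` into `LᵀPQ⁻¹L`, the parameter of `(L⁻¹Q, LᵀP)`. The sign
condition on `m` makes the scalar `c` a square root of `det L`, so `σ/c` is a square root of
`det(L⁻¹Q)`. -/
theorem transformsGaussians_dilationOp {ħ : ℝ} (hħ : 0 < ħ) (L : GL (Fin d) ℝ) (m : ℤ)
    (hm : 0 < (-1 : ℝ) ^ m * L.val.det) : TransformsGaussians hħ (dilationOp L m) (spM L) := by
  intro S σ hσ
  set l : Matrix (Fin d) (Fin d) ℂ := L.val.map Complex.ofReal with hl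
  set l' : Matrix (Fin d) (Fin d) ℂ := (L⁻¹).val.map Complex.ofReal with hl'
  have hll : l * l' = 1 := map_ofReal_mul_map_ofReal_inv L
  have hQ : Qmat (spM L * S) = l' * Qmat S := by
    rw [Qmat_mul]
    simp [spM, hl']
  have hP : Pmat (spM L * S) = lᵀ * Pmat S := by
    rw [Pmat_mul]
    simp [spM, hl, transpose_map]
  have hldet : l.det = (L.val.det : ℂ) := (RingHom.map_det Complex.ofRealHom L.val).symm
  have hdet : l.det * (Qmat (spM L * S)).det = (Qmat S).det := by
    rw [hQ, ← det_mul, ← mul_assoc, hll, one_mul]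
  set c : ℂ := Complex.I ^ m * (Real.sqrt |L.val.det| : ℂ) with hc
  have hc2 : c ^ 2 = l.det := by
    have h1 : (Complex.I ^ m) ^ 2 = (((-1 : ℝ) ^ m : ℝ) : ℂ) := by
      rw [← zpow_natCast, ← _root_.zpow_mul, mul_comm, _root_.zpow_mul]
      simp
    have h2 : ((-1 : ℝ) ^ m) * |L.val.det| = L.val.det := by
      rcases Int.even_or_odd m with h | h
      · rw [h.neg_one_zpow, one_mul] at hm ⊢
        exact abs_of_pos hm
      · rw [h.neg_one_zpow] at hm ⊢
        have : L.val.det < 0 := by linarith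
        rw [abs_of_neg this]; ring
    rw [hc, mul_pow, h1, ← Complex.ofReal_pow, Real.sq_sqrt (abs_nonneg _), ← Complex.ofReal_mul,
      h2, hldet]
  have hl0 : l.det ≠ 0 := fun h => det_Qmat_ne_zero S (by rw [← hdet, h, zero_mul])
  have hc0 : c ≠ 0 := fun h => hl0 (by rw [← hc2, h]; ring)
  refine ⟨σ / c, ?_, weightedComp_toLp _ _ _ _ _ _ _ _ _ fun x => ?_⟩
  · rw [div_pow, hσ, hc2, ← hdet, mul_div_cancel_left₀ _ hl0]
  · rw [hagedornGround_zero_apply, hagedornGround_zero_apply, ← hc]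
    have hinv : (Qmat (spM L * S))⁻¹ = (Qmat S)⁻¹ * l := by
      rw [hQ, Matrix.mul_inv_rev, Matrix.inv_eq_left_inv hll]
    have hcv : cvec (linHomeo L x) = l *ᵥ cvec x := by
      funext i
      simp [cvec, linHomeo, mulVec, dotProduct, hl]
    rw [hinv, hP, hcv]
    have : lᵀ * Pmat S * ((Qmat S)⁻¹ * l) = lᵀ * (Pmat S * (Qmat S)⁻¹) * l := by
      simp only [mul_assoc]
    rw [this, ← mulVec_mulVec, ← mulVec_mulVec, dotProduct_mulVec, vecMul_transpose, inv_div]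
    ring

/-- The companion of `Qmat_Pmat_relation` without conjugation: here the two copies of the identity
from the cross terms cancel. It makes `PQ⁻¹` symmetric, as the Gaussian integral requires. -/
theorem Qmat_Pmat_transpose (S : Sp d) : (Qmat S)ᵀ * Pmat S = (Pmat S)ᵀ * Qmat S := by
  obtain ⟨e11, e22, e12⟩ := toBlocks_relations S
  set A := S.1.toBlocks₁₁
  set B := S.1.toBlocks₁₂
  set C := S.1.toBlocks₂₁
  set D := S.1.toBlocks₂₂
  have e21 : Dᵀ * A - Bᵀ * C = 1 := by
    simpa using congrArg Matrix.transpose e12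
  let φ := (Complex.ofRealHom).mapMatrix (m := Fin d)
  have hc : ∀ M : Matrix (Fin d) (Fin d) ℝ, (φ M)ᵀ = φ Mᵀ := fun M => rfl
  have hQ : Qmat S = φ A + Complex.I • φ B := rfl
  have hP : Pmat S = φ C + Complex.I • φ D := rfl
  have f11 := congrArg φ e11
  have f22 := congrArg φ e22
  have f12 := congrArg φ (e12.trans e21.symm)
  simp only [map_mul, map_sub] at f11 f22 f12
  have f : φ Aᵀ * φ D + φ Bᵀ * φ C = φ Cᵀ * φ B + φ Dᵀ * φ A := by
    rw [sub_eq_sub_iff_add_eq_add] at f12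
    rw [f12, add_comm]
  rw [hQ, hP]
  simp only [transpose_add, transpose_smul, hc, add_mul, mul_add, smul_mul_assoc, mul_smul_comm]
  rw [f11, f22]
  have f' := congrArg (Complex.I • ·) f
  simp only [smul_add] at f' ⊢
  rw [← sub_eq_zero] at f' ⊢
  rw [← f']
  abel

theorem isSymm_Pmat_mul_inv_Qmat (S : Sp d) : (Pmat S * (Qmat S)⁻¹).IsSymm := by
  have hu := (det_Qmat_ne_zero S).isUnit
  have hu' : IsUnit (Qmat S)ᵀ.det := by rwa [det_transpose]
  rw [IsSymm, transpose_mul, transpose_nonsing_inv]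
  calc (Qmat S)ᵀ⁻¹ * (Pmat S)ᵀ = (Qmat S)ᵀ⁻¹ * ((Pmat S)ᵀ * Qmat S) * (Qmat S)⁻¹ := by
        rw [mul_assoc, mul_assoc, mul_nonsing_inv _ hu, mul_one]
    _ = _ := by rw [← Qmat_Pmat_transpose, ← mul_assoc, nonsing_inv_mul _ hu', one_mul]

/-- With `N = -(i/2ħ)PQ⁻¹` the Gaussian is `exp(-yᵀNy)`, and `hagedornExponent_re` makes `Re N`
positive definite. Its Fourier transform has parameter proportional to `N⁻¹`, hence to `QP⁻¹`, which
fits the transformed pair `(P, -Q)`. -/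
theorem transformsGaussians_fourierOp {ħ : ℝ} (hħ : 0 < ħ) :
    TransformsGaussians hħ (fourierOp (d := d) hħ) spJ := by
  intro S σ hσ
  have hħ' : (ħ : ℂ) ≠ 0 := by exact_mod_cast hħ.ne'
  have hQ : Qmat (spJ * S) = Pmat S := by
    rw [Qmat_mul]
    simp [spJ]
  have hP : Pmat (spJ * S) = -Qmat S := by
    have h1 : (spJ (d := d)).1.toBlocks₂₁.map Complex.ofReal = -1 := by
      ext i j
      simp [spJ, Matrix.one_apply, apply_ite Complex.ofReal]
    rw [Pmat_mul, h1]
    simp [spJ]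
  have hQu := (det_Qmat_ne_zero S).isUnit
  -- `P` is invertible because it is the `Q`-matrix of the symplectic matrix `JS`.
  have hPu : IsUnit (Pmat S).det := by
    rw [← hQ]
    exact (det_Qmat_ne_zero _).isUnit
  set a : ℂ := -(Complex.I / ħ * (1 / 2)) with ha
  have ha0 : a ≠ 0 := by simp [ha, hħ']
  set N := a • (Pmat S * (Qmat S)⁻¹) with hN
  have hNs : N.IsSymm := (isSymm_Pmat_mul_inv_Qmat S).smul a
  have hNexp : ∀ x : Config d, -(cvec x ⬝ᵥ N *ᵥ cvec x) = hagedornExponent ħ S 0 0 x := by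
    intro x
    rw [hN, smul_mulVec, dotProduct_smul, hagedornExponent, ha]
    simp
    ring
  have hNpos : (N.map Complex.re).PosDef := by
    refine Matrix.PosDef.of_dotProduct_mulVec_pos ?_ fun {v} hv => ?_
    · change (N.map Complex.re)ᵀ = _
      rw [← transpose_map, hNs.eq]
    · have h1 : star v ⬝ᵥ N.map Complex.re *ᵥ v =
          (cvec (WithLp.toLp 2 v) ⬝ᵥ N *ᵥ cvec (WithLp.toLp 2 v)).re := by
        simp [dotProduct, mulVec, cvec, Complex.re_sum]
      have h2 := congrArg Complex.re (hNexp (WithLp.toLp 2 v))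
      rw [hagedornExponent_re hħ, Complex.neg_re, sub_zero] at h2
      have h3 : 0 < ∑ j, ‖((Qmat S)⁻¹ *ᵥ cvec (WithLp.toLp 2 v)) j‖ ^ 2 := by
        refine lt_of_le_of_ne (by positivity) fun h => hv ?_
        have h4 : (Qmat S)⁻¹ *ᵥ cvec (WithLp.toLp 2 v) = 0 := by
          funext j
          have hz := (Finset.sum_eq_zero_iff_of_nonneg (fun i _ => by positivity)).mp h.symm j
            (Finset.mem_univ j)
          simpa using hz
        have h5 := Qmat_mulVec_inv S (cvec (WithLp.toLp 2 v))
        rw [h4, mulVec_zero] at h5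
        funext j
        have := congrFun h5 j
        simpa [cvec] using this.symm
      have h6 : 0 < (2 * ħ)⁻¹ := by positivity
      rw [h1]
      nlinarith
  obtain ⟨κ, hκ, hint⟩ := exists_integral_cexp_quadratic hNs hNpos
  have hpi : (Real.pi : ℂ) ≠ 0 := by exact_mod_cast Real.pi_ne_zero
  have hκ0 : κ ≠ 0 := by
    rintro rfl
    exact pow_ne_zero d hpi (by rw [← hκ]; ring)
  set γ : ℂ := (2 * Real.pi * ħ * Complex.I : ℂ) ^ ((d : ℂ) / 2) with hγ
  have hγ0 : γ ≠ 0 := fourier_const_ne_zero hħ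
  have hγ2 : γ ^ 2 = (2 * Real.pi * ħ * Complex.I : ℂ) ^ d := by
    rw [hγ, ← Complex.cpow_nat_mul, ← Complex.cpow_natCast]
    congr 1
    push_cast
    ring
  have hNdet : N.det = a ^ d * ((Pmat S).det / (Qmat S).det) := by
    rw [hN, det_smul, det_mul, det_nonsing_inv, Ring.inverse_eq_inv', Fintype.card_fin,
      div_eq_mul_inv]
  have hNinv : N⁻¹ = a⁻¹ • (Qmat S * (Pmat S)⁻¹) := by
    refine Matrix.inv_eq_left_inv ?_
    rw [hN, smul_mul_smul_comm, inv_mul_cancel₀ ha0, one_smul, mul_assoc,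
      nonsing_inv_mul_cancel_left _ _ hPu, mul_nonsing_inv _ hQu]
  -- The transform multiplies the amplitude `σ⁻¹` by `κ/γ`. Its square is right because `κ² det N =
  -- π^d`, `γ² = (2πħi)^d` and `2πħi · a = π`.
  refine ⟨γ * σ / κ, ?_, ?_⟩
  · rw [hQ, div_pow, mul_pow, hσ, hγ2, div_eq_iff (pow_ne_zero 2 hκ0)]
    have h1 : κ ^ 2 * a ^ d * (Pmat S).det = Real.pi ^ d * (Qmat S).det := by
      rw [← hκ, hNdet]
      field_simp [hQu.ne_zero]
    have h2 : (2 * Real.pi * ħ * Complex.I : ℂ) ^ d * a ^ d = Real.pi ^ d := by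
      rw [← mul_pow]
      congr 1
      rw [ha]
      field_simp
      simp
    have h3 : a ^ d ≠ 0 := pow_ne_zero _ ha0
    apply mul_right_cancel₀ h3
    linear_combination (Qmat S).det * h2 - h1
  · refine toLp_eq_of_ae _ _ ((fourierOp_schwartz hħ _).trans (.of_forall fun x => ?_))
    have h1 : ∀ y : Config d, Complex.exp (-(Complex.I / ħ) * (inner ℝ x y : ℝ)) *
        hagedornGround hħ S 0 0 σ y = (σ⁻¹ * ((Real.pi * ħ) ^ (-(d : ℝ) / 4) : ℝ)) *
          Complex.exp (-(cvec y ⬝ᵥ N *ᵥ cvec y) + -(Complex.I / ħ) * (inner ℝ x y : ℝ)) := by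
      intro y
      change _ * (_ * _ * Complex.exp (hagedornExponent ħ S 0 0 y)) = _
      rw [hNexp, Complex.exp_add]
      ring
    simp only [h1]
    rw [integral_const_mul, hint, hagedornGround_zero_apply, hQ, hP, hNinv, ← hγ]
    have h2 : (-(Complex.I / ħ)) ^ 2 / 4 * (cvec x ⬝ᵥ (a⁻¹ • (Qmat S * (Pmat S)⁻¹)) *ᵥ cvec x) =
        Complex.I / ħ * (1 / 2 * (cvec x ⬝ᵥ (-Qmat S * (Pmat S)⁻¹) *ᵥ cvec x)) := by
      rw [smul_mulVec, dotProduct_smul, neg_mul, neg_mulVec, dotProduct_neg, ha, smul_eq_mul]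
      field_simp
      ring
    rw [h2, inv_div, div_eq_mul_inv κ, mul_inv γ]
    ring

theorem IsMetaplecticOver.transformsGaussians {ħ : ℝ} {hħ : 0 < ħ}
    {T : L2Space d ≃ₗᵢ[ℂ] L2Space d} {S : Sp d} (h : IsMetaplecticOver hħ T S) :
    TransformsGaussians hħ T S := by
  have key : ∀ x ∈ metaplecticGraph (d := d) hħ, TransformsGaussians hħ x.1 x.2 := by
    intro x hx
    induction hx using Subgroup.closure_induction with
    | mem x hx =>
      rcases hx with (rfl | ⟨R, hR, rfl⟩) | ⟨L, m, hm, rfl⟩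
      · exact transformsGaussians_fourierOp hħ
      · exact transformsGaussians_chirpOp hħ R hR
      · exact transformsGaussians_dilationOp hħ L m hm
    | one => exact TransformsGaussians.one hħ
    | mul x y _ _ h h' => exact TransformsGaussians.mul h h'
    | inv x _ h => exact TransformsGaussians.inv h
  exact key (T, S) h

end GroundStates

/-! ### Phase space translations -/

section Translations

variable {d : ℕ}

/-- The plane wave `exp((i/ħ) p·(x - q))`. -/
def planeWave (ħ : ℝ) (q p x : Config d) : ℂ :=
  Complex.exp (Complex.I * ((ħ⁻¹ * inner ℝ p (x - q) : ℝ) : ℂ))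

theorem hasTemperateGrowth_planeWave (ħ : ℝ) (q p : Config d) :
    (planeWave ħ q p).HasTemperateGrowth := by
  refine hasTemperateGrowth_cexp (C := 0) ?_ fun x => by simp
  have h : (fun x : Config d => Complex.I * ((ħ⁻¹ * inner ℝ p (x - q) : ℝ) : ℂ)) =
      fun x => Complex.I * (ħ : ℂ)⁻¹ *
        ((Complex.ofReal ∘ fun x : Config d => (inner ℝ p x : ℝ)) -
          fun _ : Config d => ((inner ℝ p q : ℝ) : ℂ)) x := by
    funext x
    simp [inner_sub_right]
    ring
  rw [h]
  exact (Function.HasTemperateGrowth.const _).mul ((Function.HasTemperateGrowth.comp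
    Function.Complex.hasTemperateGrowth_ofReal (Function.hasTemperateGrowth_inner_right p)).sub
      (.const _))

theorem hasLineDerivAt_planeWave (ħ : ℝ) (q p x : Config d) (k : Fin d) :
    HasLineDerivAt ℝ (planeWave ħ q p) (Complex.I / ħ * p k * planeWave ħ q p x) x
      (EuclideanSpace.single k 1) := by
  have h0 : HasDerivAt (fun t : ℝ => ħ⁻¹ * (inner ℝ p (x - q) + t * p k)) (ħ⁻¹ * p k) 0 := by
    have := (((hasDerivAt_id (0 : ℝ)).mul_const (p k)).const_add (inner ℝ p (x - q))).const_mul ħ⁻¹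
    refine this.congr_deriv (by simp)
  have h1 := ((h0.ofReal_comp).const_mul Complex.I).cexp
  have hq : ∀ t : ℝ, inner ℝ p (x + t • EuclideanSpace.single k (1 : ℝ) - q) =
      inner ℝ p (x - q) + t * p k := by
    intro t
    rw [add_sub_right_comm, inner_add_right, inner_smul_right, EuclideanSpace.inner_single_right]
    simp
  unfold HasLineDerivAt planeWave
  simp only [hq]
  refine h1.congr_deriv ?_
  push_cast
  simp
  ring

/-- The operator `e^{-(i/2ħ) p·q} T_z` on Schwartz functions. -/
def schwartzWeyl (ħ : ℝ) (q p : Config d) (f : 𝓢(Config d, ℂ)) : 𝓢(Config d, ℂ) :=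
  SchwartzMap.smulLeftCLM ℂ (planeWave ħ q p) (SchwartzMap.compSubConstCLM ℂ q f)

theorem schwartzWeyl_apply (ħ : ℝ) (q p : Config d) (f : 𝓢(Config d, ℂ)) (x : Config d) :
    schwartzWeyl ħ q p f x = planeWave ħ q p x * f (x - q) := by
  rw [schwartzWeyl, SchwartzMap.smulLeftCLM_apply_apply (hasTemperateGrowth_planeWave ħ q p)]
  rfl

/-- The scalar phase shifts the Heisenberg–Weyl exponent `p·(x - q/2)` to `p·(x - q)`, the linear
term of the wave packets. -/
theorem correspondenceOp_toL2 {ħ : ℝ} (q p : Config d) {T : L2Space d ≃ₗᵢ[ℂ] L2Space d}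
    {f g : 𝓢(Config d, ℂ)} (h : T (toL2 f) = toL2 g) :
    correspondenceOp ħ q p T (toL2 f) = toL2 (schwartzWeyl ħ q p g) := by
  let c : ℂ := Complex.exp (Complex.I * ((-(inner ℝ p q) / (2 * ħ) : ℝ) : ℂ))
  have hc : c ≠ 0 := Complex.exp_ne_zero _
  have h1 : heisenbergWeyl ħ q p (toL2 g) = toL2 (c⁻¹ • schwartzWeyl ħ q p g) := by
    refine weightedComp_toLp _ _ _ _ _ _ _ _ _ fun x => ?_
    rw [_root_.smul_apply, schwartzWeyl_apply, smul_eq_mul, ← mul_assoc, planeWave]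
    congr 1
    rw [inv_mul_eq_iff_eq_mul₀ hc, ← Complex.exp_add, ← mul_add, ← Complex.ofReal_add]
    congr 3
    rw [inner_sub_right, inner_sub_right, inner_smul_right]
    -- Positivity of `ħ` is not assumed here. At `ħ = 0` both exponents vanish by the convention for
    -- division by zero.
    rcases eq_or_ne ħ 0 with rfl | hħ
    · simp
    · field_simp
      ring
  have h2 : phaseOp (-(inner ℝ p q) / (2 * ħ)) (toL2 (c⁻¹ • schwartzWeyl ħ q p g)) =
      toL2 (schwartzWeyl ħ q p g) := by
    refine weightedComp_toLp _ _ _ _ _ _ _ _ _ fun x => ?_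
    change _ = c * (c⁻¹ * _)
    rw [mul_inv_cancel_left₀ hc]
    rfl
  rw [correspondenceOp, isometry_mul_apply, isometry_mul_apply, h, h1, h2]

/-- Conjugation replaces `x̂` by `x̂ - q` and `p̂` by `p̂ - p`. The scalar term collects these
shifts. -/
theorem schwartzWeyl_phaseSpaceOp {ħ : ℝ} (hħ : 0 < ħ) (q p : Config d) (w : Fin d ⊕ Fin d → ℂ)
    (f : 𝓢(Config d, ℂ)) :
    schwartzWeyl ħ q p (phaseSpaceOp ħ w f) = phaseSpaceOp ħ w (schwartzWeyl ħ q p f) -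
      (∑ k, (w (Sum.inr k) * q k - w (Sum.inl k) * p k)) • schwartzWeyl ħ q p f := by
  ext x
  have hfd : ∀ k, fderiv ℝ (schwartzWeyl ħ q p f) x (EuclideanSpace.single k 1) =
      planeWave ħ q p x * fderiv ℝ f (x - q) (EuclideanSpace.single k 1) +
        Complex.I / ħ * p k * planeWave ħ q p x * f (x - q) := by
    intro k
    rw [schwartzWeyl, fderiv_smulLeftCLM (hasTemperateGrowth_planeWave ħ q p)
      (hasLineDerivAt_planeWave ħ q p x k), SchwartzMap.compSubConstCLM_apply]
    congr 3
    exact fderiv_comp_sub q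
  have hħ' : (ħ : ℂ) ≠ 0 := by exact_mod_cast hħ.ne'
  rw [_root_.sub_apply, _root_.smul_apply, schwartzWeyl_apply, schwartzWeyl_apply,
    phaseSpaceOp_apply, phaseSpaceOp_apply, schwartzWeyl_apply]
  simp only [hfd, smul_eq_mul]
  have e1 : ∀ k, w (Sum.inl k) * (planeWave ħ q p x *
        fderiv ℝ f (x - q) (EuclideanSpace.single k 1) +
        Complex.I / ħ * p k * planeWave ħ q p x * f (x - q)) =
      planeWave ħ q p x * (w (Sum.inl k) * fderiv ℝ f (x - q) (EuclideanSpace.single k 1)) +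
        Complex.I / ħ * planeWave ħ q p x * f (x - q) * (w (Sum.inl k) * p k) := fun k => by ring
  have e2 : ∀ k, w (Sum.inr k) * ((x - q : Config d) k : ℂ) =
      w (Sum.inr k) * x k - w (Sum.inr k) * q k := fun k => by
    rw [PiLp.sub_apply]; push_cast; ring
  simp only [e1, e2, Finset.sum_add_distrib, Finset.sum_sub_distrib, ← Finset.mul_sum]
  generalize ∑ k, w (Sum.inl k) * (p k : ℂ) = a
  field_simp
  linear_combination (-a * f (x - q) * planeWave ħ q p x) * Complex.I_sq

end Translations

/-! ### Intertwining of the two ladders -/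

section Correspondence

variable {d : ℕ}

theorem hermiteLower_eq (ħ : ℝ) (j : Fin d) (f : 𝓢(Config d, ℂ)) :
    hermiteLower ħ j f = (-(Complex.I / (Real.sqrt (2 * ħ) : ℂ))) •
      phaseSpaceOp ħ (Sum.elim (Pi.single j 1) (Pi.single j Complex.I)) f := by
  rw [phaseSpaceOp_def, Finset.sum_eq_single j (fun k _ hk => by simp [hk]) (by simp)]
  rw [hermiteLower]
  generalize ((Real.sqrt (2 * ħ) : ℝ) : ℂ) = s
  ext x
  simp
  linear_combination (s⁻¹ * posOp j f x) * Complex.I_sq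

theorem hermiteRaise_eq (ħ : ℝ) (j : Fin d) (f : 𝓢(Config d, ℂ)) :
    hermiteRaise ħ j f = (Complex.I / (Real.sqrt (2 * ħ) : ℂ)) •
      phaseSpaceOp ħ (Sum.elim (Pi.single j 1) (Pi.single j (-Complex.I))) f := by
  rw [phaseSpaceOp_def, Finset.sum_eq_single j (fun k _ hk => by simp [hk]) (by simp)]
  rw [hermiteRaise]
  generalize ((Real.sqrt (2 * ħ) : ℝ) : ℂ) = s
  ext x
  simp
  linear_combination (s⁻¹ * posOp j f x) * Complex.I_sq

/-- For `c = i` the result is the `j`-th column of `(Q, P)`, and for `c = -i` its conjugate: the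
coefficients of the Hagedorn lowering and raising operators. -/
theorem cmat_mulVec_single (S : Sp d) (j : Fin d) (c : ℂ) :
    cmat S *ᵥ Sum.elim (Pi.single j 1) (Pi.single j c) = Sum.elim
      (fun k => (S.1.toBlocks₁₁ k j : ℂ) + S.1.toBlocks₁₂ k j * c)
      (fun k => (S.1.toBlocks₂₁ k j : ℂ) + S.1.toBlocks₂₂ k j * c) := by
  rw [cmat, ← Matrix.fromBlocks_toBlocks S.1, fromBlocks_map, fromBlocks_mulVec]
  ext (k | k) <;> simp [mul_comm c]

theorem hagedornLower_eq (ħ : ℝ) (S : Sp d) (q p : Config d) (j : Fin d) (f : 𝓢(Config d, ℂ))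
    {w : Fin d ⊕ Fin d → ℂ}
    (hw : w = cmat S *ᵥ Sum.elim (Pi.single j 1) (Pi.single j Complex.I)) :
    hagedornLower ħ S q p j f = (-(Complex.I / (Real.sqrt (2 * ħ) : ℂ))) • (phaseSpaceOp ħ w f -
      (∑ k, (w (Sum.inr k) * q k - w (Sum.inl k) * p k)) • f) := by
  rw [cmat_mulVec_single] at hw
  subst hw
  rw [phaseSpaceOp_def, Finset.sum_smul, ← Finset.sum_sub_distrib, hagedornLower,
    _root_.smul_apply, _root_.sum_apply]
  congr 1
  refine Finset.sum_congr rfl fun k _ => ?_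
  ext x
  simp [Qmat, Pmat]
  ring

theorem hagedornRaise_eq (ħ : ℝ) (S : Sp d) (q p : Config d) (j : Fin d) (f : 𝓢(Config d, ℂ))
    {w : Fin d ⊕ Fin d → ℂ}
    (hw : w = cmat S *ᵥ Sum.elim (Pi.single j 1) (Pi.single j (-Complex.I))) :
    hagedornRaise ħ S q p j f = (Complex.I / (Real.sqrt (2 * ħ) : ℂ)) • (phaseSpaceOp ħ w f -
      (∑ k, (w (Sum.inr k) * q k - w (Sum.inl k) * p k)) • f) := by
  rw [cmat_mulVec_single] at hw
  subst hw
  rw [phaseSpaceOp_def, Finset.sum_smul, ← Finset.sum_sub_distrib, hagedornRaise,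
    _root_.smul_apply, _root_.sum_apply]
  congr 1
  refine Finset.sum_congr rfl fun k _ => ?_
  ext x
  simp [Qmat, Pmat]
  ring

/-- Affine covariance: `T` contributes the linear part `S`, the translation the shift by `(q, p)`.
-/
theorem IsCovariant.correspondenceOp_phaseSpaceOp {ħ : ℝ} (hħ : 0 < ħ)
    {T : L2Space d ≃ₗᵢ[ℂ] L2Space d} {S : Sp d} (hT : IsCovariant ħ T S) (q p : Config d)
    {f g : 𝓢(Config d, ℂ)} (h : correspondenceOp ħ q p T (toL2 f) = toL2 g)
    (w : Fin d ⊕ Fin d → ℂ) :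
    correspondenceOp ħ q p T (toL2 (phaseSpaceOp ħ w f)) =
      toL2 (phaseSpaceOp ħ (cmat S *ᵥ w) g - (∑ k, ((cmat S *ᵥ w) (Sum.inr k) * q k -
        (cmat S *ᵥ w) (Sum.inl k) * p k)) • g) := by
  obtain ⟨g₀, hg₀⟩ := hT.map f
  have hg : g = schwartzWeyl ħ q p g₀ :=
    toLp_injective (h.symm.trans (correspondenceOp_toL2 q p hg₀))
  rw [correspondenceOp_toL2 q p (hT.cov f g₀ hg₀ w), schwartzWeyl_phaseSpaceOp hħ, hg]

theorem map_toL2_prod_ofFn (U : L2Space d ≃ₗᵢ[ℂ] L2Space d)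
    {a A : Fin d → 𝓢(Config d, ℂ) →L[ℂ] 𝓢(Config d, ℂ)}
    (h : ∀ j f g, U (toL2 f) = toL2 g → U (toL2 (a j f)) = toL2 (A j g)) (n : Fin d → ℕ)
    {f g : 𝓢(Config d, ℂ)} (hfg : U (toL2 f) = toL2 g) :
    U (toL2 ((List.ofFn fun j => a j ^ n j).prod f)) =
      toL2 ((List.ofFn fun j => A j ^ n j).prod g) := by
  have hpow : ∀ (j : Fin d) (k : ℕ) (f g : 𝓢(Config d, ℂ)), U (toL2 f) = toL2 g →
      U (toL2 ((a j ^ k) f)) = toL2 ((A j ^ k) g) := by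
    intro j k
    induction k with
    | zero => intro f g hfg; simpa using hfg
    | succ k ih =>
      intro f g hfg
      rw [pow_succ', pow_succ', mul_apply_eq_comp, mul_apply_eq_comp]
      exact h j _ _ (ih f g hfg)
  rw [List.ofFn_eq_map, List.ofFn_eq_map]
  induction List.finRange d with
  | nil => simpa using hfg
  | cons j l ih =>
    rw [List.map_cons, List.map_cons, List.prod_cons, List.prod_cons, mul_apply_eq_comp,
      mul_apply_eq_comp]
    exact hpow j _ _ _ ih

theorem schwartzWeyl_hagedornGround {ħ : ℝ} (hħ : 0 < ħ) (S : Sp d) (q p : Config d) (σ : ℂ) :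
    schwartzWeyl ħ q p (hagedornGround hħ S 0 0 σ) = hagedornGround hħ S q p σ := by
  ext x
  rw [schwartzWeyl_apply, hagedornGround_zero_apply]
  change _ = _ * _ * Complex.exp (hagedornExponent ħ S q p x)
  rw [planeWave, mul_left_comm, ← Complex.exp_add, hagedornExponent]
  congr 2
  push_cast
  ring

theorem Qmat_one : Qmat (1 : Sp d) = 1 := by
  ext i j
  by_cases h : i = j <;> simp [Qmat, toBlocks₁₁, toBlocks₁₂, Matrix.one_apply, h]

/-- The identity has `Q = 1` and `P = i`, so its Gaussian with root `1` is the oscillator ground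
state. This is the starting point for transporting ground states. -/
theorem hermiteFunction_zero {ħ : ℝ} (hħ : 0 < ħ) :
    hermiteFunction (d := d) hħ 0 = hagedornGround hħ 1 0 0 1 := by
  have hP : Pmat (1 : Sp d) = Complex.I • 1 := by
    ext i j
    by_cases h : i = j <;> simp [Pmat, toBlocks₂₁, toBlocks₂₂, Matrix.one_apply, h]
  have hħ' : (ħ : ℂ) ≠ 0 := by exact_mod_cast hħ.ne'
  ext x
  rw [hagedornGround_zero_apply, Qmat_one, hP, inv_one, inv_one, mul_one, one_mul, smul_mulVec, one_mulVec,
    dotProduct_smul, smul_eq_mul]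
  change ((ħ ^ (-(d : ℝ) / 4) * ∏ j, hermiteFun1 0 (x j / Real.sqrt ħ) : ℝ) : ℂ) = _
  have h1 : Complex.I / ħ * (1 / 2 * (Complex.I * (cvec x ⬝ᵥ cvec x))) =
      ((∑ j, -(x j / Real.sqrt ħ) ^ 2 / 2 : ℝ) : ℂ) := by
    have : ∀ j, -(x j / Real.sqrt ħ) ^ 2 / 2 = -(2 * ħ)⁻¹ * (x j * x j) := by
      intro j
      rw [div_pow, Real.sq_sqrt hħ.le]
      field_simp
    simp only [this, ← Finset.mul_sum]
    push_cast
    simp only [dotProduct, cvec]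
    field_simp
    linear_combination (∑ j, (x j : ℂ) ^ 2) * Complex.I_sq
  rw [h1, ← Complex.ofReal_exp, ← Complex.ofReal_mul, Real.exp_sum]
  congr 1
  simp only [hermiteFun1, hermitePoly, Finset.prod_mul_distrib]
  rw [← mul_assoc]
  congr 1
  rw [Real.mul_rpow Real.pi_pos.le hħ.le, mul_comm]
  congr 1
  simp only [Polynomial.eval_one, pow_zero, Nat.factorial_zero, Nat.cast_one, mul_one,
    Real.sqrt_one, one_mul, one_div]
  rw [← Real.rpow_neg Real.pi_pos.le, Finset.prod_const, Finset.card_univ,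
    Fintype.card_fin, ← Real.rpow_natCast, ← Real.rpow_mul Real.pi_pos.le]
  congr 1
  ring

/-- Intertwining propagates the identity from level zero to all levels, since both families are
generated by raising operators with the same normalisation. -/
theorem ladderCorrespondence_of_ground {ħ : ℝ} (hħ : 0 < ħ) {T : L2Space d ≃ₗᵢ[ℂ] L2Space d}
    {S : Sp d} (hT : IsCovariant ħ T S) (q p : Config d) {σ : ℂ}
    (h₀ : T (toL2 (hermiteFunction hħ 0)) = toL2 (hagedornGround hħ S 0 0 σ)) :
    LadderCorrespondence (correspondenceOp ħ q p T) (hermiteFunction hħ)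
      (hagedornPacket hħ S q p σ) (hermiteLower ħ) (hermiteRaise ħ)
      (hagedornLower ħ S q p) (hagedornRaise ħ S q p) := by
  set U := correspondenceOp ħ q p T with hU
  have hground : U (toL2 (hermiteFunction hħ 0)) = toL2 (hagedornGround hħ S q p σ) := by
    rw [hU, correspondenceOp_toL2 q p h₀, schwartzWeyl_hagedornGround]
  have hsmul : ∀ (c : ℂ) (f g : 𝓢(Config d, ℂ)), U (toL2 f) = toL2 g →
      U (toL2 (c • f)) = toL2 (c • g) := by
    intro c f g h
    rw [toLp_smul, toLp_smul, map_smul, h]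
  have hraise : ∀ j f g, U (toL2 f) = toL2 g →
      U (toL2 (hermiteRaise ħ j f)) = toL2 (hagedornRaise ħ S q p j g) := by
    intro j f g h
    rw [hermiteRaise_eq, hagedornRaise_eq ħ S q p j g rfl]
    exact hsmul _ _ _ (hT.correspondenceOp_phaseSpaceOp hħ q p h _)
  have hlower : ∀ j f g, U (toL2 f) = toL2 g →
      U (toL2 (hermiteLower ħ j f)) = toL2 (hagedornLower ħ S q p j g) := by
    intro j f g h
    rw [hermiteLower_eq, hagedornLower_eq ħ S q p j g rfl]
    exact hsmul _ _ _ (hT.correspondenceOp_phaseSpaceOp hħ q p h _)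
  have hprod := prod_ofFn_pow_apply (hermiteFunction hħ) (hermiteRaise ħ)
    (hermiteRaise_hermiteFunction (d := d) hħ)
  have hmap : ∀ n, U (toL2 (hermiteFunction hħ n)) = toL2 (hagedornPacket hħ S q p σ n) := by
    intro n
    have hpos : 0 < Real.sqrt (∏ j, ((n j).factorial : ℝ)) :=
      Real.sqrt_pos.mpr (Finset.prod_pos fun j _ => by positivity)
    have hne : ((Real.sqrt (∏ j, ((n j).factorial : ℝ)) : ℝ) : ℂ) ≠ 0 := by
      exact_mod_cast hpos.ne'
    have := hsmul (((Real.sqrt (∏ j, ((n j).factorial : ℝ)) : ℝ) : ℂ)⁻¹) _ _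
      (map_toL2_prod_ofFn U hraise n hground)
    rw [hprod, inv_smul_smul₀ hne] at this
    exact this
  have hup : ∀ (n : Fin d → ℕ) (j : Fin d), hermiteFunction hħ (n + Pi.single j 1) =
      ((Real.sqrt (n j + 1) : ℝ) : ℂ)⁻¹ • hermiteRaise ħ j (hermiteFunction hħ n) := by
    intro n j
    have hpos : 0 < Real.sqrt ((n j : ℝ) + 1) := Real.sqrt_pos.mpr (by positivity)
    rw [hermiteRaise_hermiteFunction, inv_smul_smul₀]
    exact_mod_cast hpos.ne'
  have hdown : ∀ (n : Fin d → ℕ) (j : Fin d), 1 ≤ n j → hermiteFunction hħ (n - Pi.single j 1) =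
      ((Real.sqrt (n j) : ℝ) : ℂ)⁻¹ • hermiteLower ħ j (hermiteFunction hħ n) := by
    intro n j hn
    have hpos : 0 < Real.sqrt (n j : ℝ) := Real.sqrt_pos.mpr (by exact_mod_cast hn)
    rw [hermiteLower_hermiteFunction hħ n j hn, inv_smul_smul₀]
    exact_mod_cast hpos.ne'
  have hupU := fun n j => hsmul ((Real.sqrt (n j + 1) : ℝ) : ℂ)⁻¹ _ _ (hraise j _ _ (hmap n))
  have hdownU := fun n j => hsmul ((Real.sqrt (n j) : ℝ) : ℂ)⁻¹ _ _ (hlower j _ _ (hmap n))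
  exact
    { map_eq := fun n => (hmap n).symm
      lower_left := hdown
      -- The Hagedorn ladder is the image of the Hermite ladder under `U`, so no commutation
      -- relations for `A_j`, `A*_j` are needed.
      lower_right := fun n j hn => toLp_injective (by rw [← hdownU, ← hdown n j hn, hmap])
      lower_comm := fun n j _ => hdownU n j
      raise_left := hup
      raise_right := fun n j => toLp_injective (by rw [← hupU, ← hup, hmap])
      raise_comm := hupU }

theorem IsMetaplecticOver.exists_ground {ħ : ℝ} {hħ : 0 < ħ} {T : L2Space d ≃ₗᵢ[ℂ] L2Space d}
    {S : Sp d} (h : IsMetaplecticOver hħ T S) :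
    ∃ σ : ℂ, σ ^ 2 = (Qmat S).det ∧
      T (toL2 (hermiteFunction hħ 0)) = toL2 (hagedornGround hħ S 0 0 σ) := by
  have h1 : (1 : ℂ) ^ 2 = (Qmat (1 : Sp d)).det := by
    rw [Qmat_one, det_one, one_pow]
  obtain ⟨σ, hσ, h2⟩ := h.transformsGaussians 1 1 h1
  rw [mul_one] at hσ h2
  exact ⟨σ, hσ, by rw [hermiteFunction_zero, h2]⟩

end Correspondence

end

/-- The Hagedorn–Hermite correspondence. Hagedorn's wave packets are double-valued in `S`, through
the choice of a square root `σ` of `det Q`, just as metaplectic operators over `S` come in pairs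
`±Ŝ`; the two choices determine each other. -/
theorem mainTheorem1 {d : ℕ} {ħ : ℝ} (hħ : 0 < ħ) (S : Sp d) (q p : Config d) :
    (∀ T : L2Space d ≃ₗᵢ[ℂ] L2Space d, IsMetaplecticOver hħ T S →
      ∃ σ : ℂ, σ ^ 2 = (Qmat S).det ∧
        LadderCorrespondence (correspondenceOp ħ q p T) (hermiteFunction hħ)
          (hagedornPacket hħ S q p σ) (hermiteLower ħ) (hermiteRaise ħ)
          (hagedornLower ħ S q p) (hagedornRaise ħ S q p)) ∧
    (∀ σ : ℂ, σ ^ 2 = (Qmat S).det →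
      ∃ T : L2Space d ≃ₗᵢ[ℂ] L2Space d, IsMetaplecticOver hħ T S ∧
        LadderCorrespondence (correspondenceOp ħ q p T) (hermiteFunction hħ)
          (hagedornPacket hħ S q p σ) (hermiteLower ħ) (hermiteRaise ħ)
          (hagedornLower ħ S q p) (hagedornRaise ħ S q p)) := by
  refine ⟨fun T hT => ?_, fun σ hσ => ?_⟩
  · obtain ⟨σ, hσ, h⟩ := hT.exists_ground
    exact ⟨σ, hσ, ladderCorrespondence_of_ground hħ hT.isCovariant q p h⟩
  · obtain ⟨T, hT⟩ := exists_isMetaplecticOver hħ S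
    obtain ⟨σ₀, hσ₀, h⟩ := hT.exists_ground
    rcases sq_eq_sq_iff_eq_or_eq_neg.mp (hσ.trans hσ₀.symm) with rfl | rfl
    · exact ⟨T, hT, ladderCorrespondence_of_ground hħ hT.isCovariant q p h⟩
    -- If the lift produces the opposite root, composing it with `-1`, which lies over the identity,
    -- flips the sign.
    · have hT' : IsMetaplecticOver hħ (dilationOp 1 2 * T) S := by
        have := mul_mem (isMetaplecticOver_neg_one hħ) hT
        rwa [Prod.mk_mul_mk, one_mul] at this
      refine ⟨_, hT', ladderCorrespondence_of_ground hħ hT'.isCovariant q p ?_⟩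
      rw [isometry_mul_apply, h, dilationOp_one_two, hagedornGround_neg, toL2_neg]
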